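/- Let $\mathbf E_1^3$ be $\mathbb R^3$ with the Lorentzian metric $\langle\,,\rangle=dx_1^2+dx_2^2-dx_3^2$. For a smooth nondegenerate immersion $X:\Omega\to\mathbf E_1^3$ of a nonempty connected open set $\Omega\subset\mathbb R^2$ with coordinates $(u,v)$, let $N=X_u\times X_v/|X_u\times X_v|$ be its unit normal, $\mathrm I$ and $\mathrm{II}$ the matrices of the first and second fundamental forms with respect to $X_u,X_v$ (so $\mathrm{II}_{ij}=\langle X_{ij},N\rangle$), and $W=\mathrm I^{-1}\mathrm{II}$ the matrix of the Weingarten endomorphism. The mean curvature vanishes identically (the surface is ZMC) if and only if $\operatorname{tr}W\equiv 0$; a point is umbilic if $W$ is a multiple of the identity there. The surface is called intrinsic rotational with $\delta=-\epsilon=1$ if $\mathrm I=\rho(u)^2(du^2-dv^2)$ on $\Omega$ for some function $\rho>0$ of $u$ (it is then timelike), and it has twist $\alpha$ if there are functions $\lambda_1,\lambda_2$ of $u$ with $$W=G_{-\alpha(v)}\begin{pmatrix}\lambda_1(u)&0\\0&\lambda_2(u)\end{pmatrix}G_{\alpha(v)},\qquad G_\theta=\begin{pmatrix}\cosh\theta&\sinh\theta\\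 \sinh\theta&\cosh\theta\end{pmatrix}.$$ For $a\in\mathbb R\setminus\{0\}$ and $A,B>0$ let $X_{a,A,B}:\mathbb R^2\to\mathbf E_1^3$ be the following map. 1. If $B\neq\pm 2a$, $$X_{a,A,B}(u,v)=\begin{pmatrix}\dfrac{e^{2au}\cosh(2av)}{2aB}\\[2mm] \dfrac{e^{(2a-B)u}\left((2a+B)\cosh((2a-B)v)-A^2(2a-B)e^{2Bu}\cosh((2a+B)v)\right)}{2AB(4a^2-B^2)}\\[2mm] -\dfrac{e^{(2a-B)u}\left(A^2(2a-B)e^{2Bu}\sinh((2a+B)v)+(2a+B)\sinh((2a-B)v)\right)}{2AB(4a^2-B^2)}\end{pmatrix}.$$ 2. If $B=2a$, $$X_{a,A,B}(u,v)=\left(\frac{e^{2au}\cosh(2av)}{4a^2},\ \frac{4au-A^2e^{4au}\cosh(4av)}{16a^2A},\ -\frac{A^2e^{4au}\sinh(4av)+4av}{16a^2A}\right).$$ 3. If $B=-2a$, $$X_{a,A,B}(u,v)=\left(-\frac{e^{2au}\cosh(2av)}{4a^2},\ \frac{4aA^2u-e^{4au}\cosh(4av)}{16a^2A},\ \frac{4aA^2v+e^{4au}\sinh(4av)}{16a^2A}\right).$$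 **Theorem.** Let $a\neq0$. (i) Let $X:\Omega\to\mathbf E_1^3$ be an intrinsic rotational ZMC surface with $\delta=-\epsilon=1$ and twist $\alpha(v)=av$, whose set of umbilic points contains no nonempty open set. Then there are $A,B>0$, a factor $c>0$ and an (affine) isometry $\Phi$ of $\mathbf E_1^3$ such that $X(u,v)=\Phi\big(c\,X_{a,A,B}(u,v)\big)$ for all $(u,v)\in\Omega$. Also, without a homothety but after a translation of $u$, there are $A,B>0$, $t\in\mathbb R$ and an isometry $\Phi$ such that $X(u,v)=\Phi\big(X_{a,A,B}(u+t,v)\big)$ for all $(u,v)\in\Omega$. (ii) Conversely, for all $A,B>0$ the map $X_{a,A,B}$, defined on all of $\mathbb R^2$, is a timelike intrinsic rotational ZMC surface with $\delta=-\epsilon=1$ and twist $\alpha(v)=av$, whose set of umbilic points contains no nonempty open set. Its first fundamental form is $$\mathrm I=\frac{e^{(4a-2B)u}(A^2e^{2Bu}+1)^2}{4A^2B^2}(du^2-dv^2)\ \ (B\neq\pm2a),$$ $$\mathrm I=\frac{(A^2e^{4au}+1)^2}{16a^2A^2}(du^2-dv^2)\ \ (B=2a),\qquad \mathrm I=\frac{(A^2+e^{4au})^2}{16a^2A^2}(du^2-dv^2)\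 \ (B=-2a).$$ (iii) The case $a=A=B=1$ is, up to the homothety of ratio $1/2$, an isometry of $\mathbf E_1^3$ and a change of coordinates, the timelike Enneper surface $E(x,y)=\left(x^2+y^2,\ x-\frac{x^3}{3}-xy^2,\ y+\frac{y^3}{3}+yx^2\right)$: there is an isometry $\Phi$ of $\mathbf E_1^3$ with $X_{1,1,1}(u,v)=\Phi\big(\tfrac12E(e^u\cosh v,e^u\sinh v)\big)$ for all $u,v\in\mathbb R$. -/

import Mathlib

open scoped ContDiff Matrix

noncomputable section

/-- The Lorentzian metric `dx₁² + dx₂² - dx₃²` of the Lorentz-Minkowski space. -/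
def lorentz (x y : Fin 3 → ℝ) : ℝ := x 0 * y 0 + x 1 * y 1 - x 2 * y 2

/-- The Lorentzian cross product, characterised by `⟨x × y, z⟩ = det (x, y, z)`. -/
def lorentzCross (x y : Fin 3 → ℝ) : Fin 3 → ℝ :=
  ![x 1 * y 2 - x 2 * y 1, x 2 * y 0 - x 0 * y 2, x 1 * y 0 - x 0 * y 1]

/-- The (affine) isometries of the Lorentz-Minkowski space. -/
def IsLorentzIsometry (Φ : (Fin 3 → ℝ) → (Fin 3 → ℝ)) : Prop :=
  ∃ (L : Matrix (Fin 3) (Fin 3) ℝ) (w : Fin 3 → ℝ),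
    (∀ x y, lorentz (L *ᵥ x) (L *ᵥ y) = lorentz x y) ∧ ∀ x, Φ x = L *ᵥ x + w

/-- Partial derivative with respect to the first coordinate `u`. -/
def partialU (X : ℝ × ℝ → Fin 3 → ℝ) (p : ℝ × ℝ) : Fin 3 → ℝ := fderiv ℝ X p (1, 0)

/-- Partial derivative with respect to the second coordinate `v`. -/
def partialV (X : ℝ × ℝ → Fin 3 → ℝ) (p : ℝ × ℝ) : Fin 3 → ℝ := fderiv ℝ X p (0, 1)

/-- Matrix of the first fundamental form in the basis `X_u, X_v`. -/
def firstForm (X : ℝ × ℝ → Fin 3 → ℝ) (p : ℝ × ℝ) : Matrix (Fin 2) (Fin 2) ℝ :=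
  !![lorentz (partialU X p) (partialU X p), lorentz (partialU X p) (partialV X p);
     lorentz (partialV X p) (partialU X p), lorentz (partialV X p) (partialV X p)]

/-- The unit normal `N = X_u × X_v / |X_u × X_v|`. -/
def unitNormal (X : ℝ × ℝ → Fin 3 → ℝ) (p : ℝ × ℝ) : Fin 3 → ℝ :=
  (Real.sqrt |lorentz (lorentzCross (partialU X p) (partialV X p))
      (lorentzCross (partialU X p) (partialV X p))|)⁻¹ •
    lorentzCross (partialU X p) (partialV X p)

/-- Matrix of the second fundamental form (its component along `N`) in the basis `X_u, X_v`. -/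
def secondForm (X : ℝ × ℝ → Fin 3 → ℝ) (p : ℝ × ℝ) : Matrix (Fin 2) (Fin 2) ℝ :=
  !![lorentz (partialU (partialU X) p) (unitNormal X p),
     lorentz (partialU (partialV X) p) (unitNormal X p);
     lorentz (partialV (partialU X) p) (unitNormal X p),
     lorentz (partialV (partialV X) p) (unitNormal X p)]

/-- Matrix of the Weingarten endomorphism in the basis `X_u, X_v`. -/
def weingarten (X : ℝ × ℝ → Fin 3 → ℝ) (p : ℝ × ℝ) : Matrix (Fin 2) (Fin 2) ℝ :=
  (firstForm X p)⁻¹ * secondForm X p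

/-- The parametrized surface is spacelike on `Ω`: the induced metric is Riemannian. -/
def IsSpacelikeOn (Ω : Set (ℝ × ℝ)) (X : ℝ × ℝ → Fin 3 → ℝ) : Prop :=
  ∀ p ∈ Ω, (firstForm X p).PosDef

/-- The parametrized surface is timelike on `Ω`: the induced metric is Lorentzian. -/
def IsTimelikeOn (Ω : Set (ℝ × ℝ)) (X : ℝ × ℝ → Fin 3 → ℝ) : Prop :=
  ∀ p ∈ Ω, (firstForm X p).det < 0

/-- The mean curvature `H = -σ (trace A) / 2`, where `σ = 1` at spacelike points and `σ = -1`
at timelike points. -/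
def meanCurvature (X : ℝ × ℝ → Fin 3 → ℝ) (p : ℝ × ℝ) : ℝ :=
  -(SignType.sign (firstForm X p).det : ℝ) * (weingarten X p).trace / 2

/-- Zero mean curvature on `Ω`. -/
def IsZMCOn (Ω : Set (ℝ × ℝ)) (X : ℝ × ℝ → Fin 3 → ℝ) : Prop :=
  ∀ p ∈ Ω, meanCurvature X p = 0

/-- Umbilic points: the Weingarten endomorphism is a multiple of the identity. -/
def IsUmbilicAt (X : ℝ × ℝ → Fin 3 → ℝ) (p : ℝ × ℝ) : Prop :=
  ∃ c : ℝ, weingarten X p = c • (1 : Matrix (Fin 2) (Fin 2) ℝ)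

/-- The set of umbilic points contains no nonempty open set. -/
def NoOpenUmbilicSet (Ω : Set (ℝ × ℝ)) (X : ℝ × ℝ → Fin 3 → ℝ) : Prop :=
  interior {p | p ∈ Ω ∧ IsUmbilicAt X p} = ∅

/-- `X : Ω → E₁³` is a surface with coordinates `(u, v)` in a connected open set `Ω` whose first
fundamental form is `ρ(u)² (δ du² + ε dv²)` with `ρ > 0`. For `δ, ε ∈ {-1, 1}` the form is
nondegenerate, so that `X` is an immersion. -/
structure IsIntrinsicRotational (δ ε : ℝ) (Ω : Set (ℝ × ℝ)) (X : ℝ × ℝ → Fin 3 → ℝ) : Prop where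
  isOpen : IsOpen Ω
  isConnected : IsConnected Ω
  smooth : ContDiffOn ℝ ∞ X Ω
  sign_left : δ = 1 ∨ δ = -1
  sign_right : ε = 1 ∨ ε = -1
  metric : ∃ ρ : ℝ → ℝ, ∀ p ∈ Ω, 0 < ρ p.1 ∧ firstForm X p = ρ p.1 ^ 2 • !![δ, 0; 0, ε]

/-- Euclidean rotation. -/
def rotR (θ : ℝ) : Matrix (Fin 2) (Fin 2) ℝ :=
  !![Real.cos θ, -Real.sin θ; Real.sin θ, Real.cos θ]

/-- Hyperbolic rotation. -/
def rotG (θ : ℝ) : Matrix (Fin 2) (Fin 2) ℝ :=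
  !![Real.cosh θ, Real.sinh θ; Real.sinh θ, Real.cosh θ]

/-- The surface `X : Ω → E₁³` has twist `α`. -/
def HasTwist (Ω : Set (ℝ × ℝ)) (X : ℝ × ℝ → Fin 3 → ℝ) (α : ℝ → ℝ) : Prop :=
  ContDiff ℝ ∞ α ∧ ∃ l₁ l₂ : ℝ → ℝ,
    (IsSpacelikeOn Ω X ∧ ∀ p ∈ Ω,
      weingarten X p = rotR (-α p.2) * !![l₁ p.1, 0; 0, l₂ p.1] * rotR (α p.2)) ∨
    (IsTimelikeOn Ω X ∧ ∀ p ∈ Ω,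
      weingarten X p = rotG (-α p.2) * !![l₁ p.1, 0; 0, l₂ p.1] * rotG (α p.2))

/-- The parametrization in the case `B ≠ ± 2a`. -/
def paramGeneric (a A B : ℝ) (p : ℝ × ℝ) : Fin 3 → ℝ :=
  ![Real.exp (2 * a * p.1) * Real.cosh (2 * a * p.2) / (2 * a * B),
    Real.exp ((2 * a - B) * p.1) *
      ((2 * a + B) * Real.cosh ((2 * a - B) * p.2) -
        A ^ 2 * (2 * a - B) * Real.exp (2 * B * p.1) * Real.cosh ((2 * a + B) * p.2)) /
      (2 * A * B * (4 * a ^ 2 - B ^ 2)),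
    -(Real.exp ((2 * a - B) * p.1) *
      (A ^ 2 * (2 * a - B) * Real.exp (2 * B * p.1) * Real.sinh ((2 * a + B) * p.2) +
        (2 * a + B) * Real.sinh ((2 * a - B) * p.2)) /
      (2 * A * B * (4 * a ^ 2 - B ^ 2)))]

/-- The parametrization in the case `B = 2a`. -/
def paramPlus (a A : ℝ) (p : ℝ × ℝ) : Fin 3 → ℝ :=
  ![Real.exp (2 * a * p.1) * Real.cosh (2 * a * p.2) / (4 * a ^ 2),
    (4 * a * p.1 - A ^ 2 * Real.exp (4 * a * p.1) * Real.cosh (4 * a * p.2)) / (16 * a ^ 2 * A),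
    -((A ^ 2 * Real.exp (4 * a * p.1) * Real.sinh (4 * a * p.2) + 4 * a * p.2) /
      (16 * a ^ 2 * A))]

/-- The parametrization in the case `B = -2a`. -/
def paramMinus (a A : ℝ) (p : ℝ × ℝ) : Fin 3 → ℝ :=
  ![-(Real.exp (2 * a * p.1) * Real.cosh (2 * a * p.2) / (4 * a ^ 2)),
    (4 * a * A ^ 2 * p.1 - Real.exp (4 * a * p.1) * Real.cosh (4 * a * p.2)) / (16 * a ^ 2 * A),
    (4 * a * A ^ 2 * p.2 + Real.exp (4 * a * p.1) * Real.sinh (4 * a * p.2)) / (16 * a ^ 2 * A)]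

open Classical in
/-- The explicit parametrization with parameters `a ≠ 0`, `A > 0`, `B > 0`. -/
def timelikeParam (a A B : ℝ) : ℝ × ℝ → Fin 3 → ℝ :=
  if B = 2 * a then paramPlus a A
  else if B = -(2 * a) then paramMinus a A
  else paramGeneric a A B

/-- The timelike Enneper surface, in polynomial coordinates. -/
def timelikeEnneper (p : ℝ × ℝ) : Fin 3 → ℝ :=
  ![p.1 ^ 2 + p.2 ^ 2, p.1 - p.1 ^ 3 / 3 - p.1 * p.2 ^ 2, p.2 + p.2 ^ 3 / 3 + p.2 * p.1 ^ 2]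

end

/-! Write `I = E (du² - dv²)` with `E` a function of `u`, and let `e = ⟨X_uu, N⟩`, `f = ⟨X_uv, N⟩`,
`κ = E_u / (2E)`. Zero trace and the linear twist force `e = H cosh (2av)`, `f = H sinh (2av)` with
`H` a function of `u`, and `⟨X_vv, N⟩ = e`. The compatibility equations then become ordinary
differential equations in `u` that integrate in closed form. Codazzi gives `H' = 2aH`, so `H = C exp
(2au)`. Gauss gives `κ' = H² / E`, whence `(κ - 2a)² + H² / E` is a positive constant `B²`. So `κ -
2a` solves the Riccati equation `k' = B² - k²`, and `(B + k) / (B - k) = A² exp (2Bu)` introduces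
the last constant `A`. These relations determine `E` (`AdaptedFrame.forms_eq`).

The explicit surface with parameters `a, A, B` realizes these forms with `C = -1` for its unit
normal. Reversing the normal adjusts the sign of `C`, and a homothety, or else a translation of `u`,
adjusts its size. The fundamental theorem of surfaces (`AdaptedFrame.exists_isometry`) then gives
the isometry.

`Ω` is only open and connected, so its slices may be disconnected. Each integration is therefore
phrased as a first integral on `Ω`, a function whose two partial derivatives vanish. -/

noncomputable section

/-! ### Directional derivatives on an open set of the plane -/

/-- The derivative of `f` in the direction `e`. -/
def dirD {F : Type*} [NormedAddCommGroup F] [NormedSpace ℝ F] (e : ℝ × ℝ) (f : ℝ × ℝ → F)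
    (p : ℝ × ℝ) : F := fderiv ℝ f p e

section Calculus

variable {F : Type*} [NormedAddCommGroup F] [NormedSpace ℝ F] {Ω : Set (ℝ × ℝ)}

theorem ContDiffOn.differentiableAt_of_isOpen (hΩ : IsOpen Ω) {f : ℝ × ℝ → F}
    (hf : ContDiffOn ℝ ∞ f Ω) {p : ℝ × ℝ} (hp : p ∈ Ω) : DifferentiableAt ℝ f p :=
  (hf.contDiffAt (hΩ.mem_nhds hp)).differentiableAt (by simp)

theorem contDiffOn_dirD (hΩ : IsOpen Ω) {f : ℝ × ℝ → F} (hf : ContDiffOn ℝ ∞ f Ω) (e : ℝ × ℝ) :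
    ContDiffOn ℝ ∞ (dirD e f) Ω :=
  (hf.fderiv_of_isOpen hΩ (m := ∞) (by simp)).clm_apply contDiffOn_const

theorem dirD_congr (hΩ : IsOpen Ω) {f g : ℝ × ℝ → F} (h : ∀ p ∈ Ω, f p = g p) (e : ℝ × ℝ)
    {p : ℝ × ℝ} (hp : p ∈ Ω) : dirD e f p = dirD e g p := by
  have : f =ᶠ[nhds p] g := Filter.eventuallyEq_of_mem (hΩ.mem_nhds hp) h
  rw [dirD, dirD, this.fderiv_eq]

theorem dirD_comm (hΩ : IsOpen Ω) {f : ℝ × ℝ → F} (hf : ContDiffOn ℝ ∞ f Ω) (e e' : ℝ × ℝ)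
    {p : ℝ × ℝ} (hp : p ∈ Ω) : dirD e (dirD e' f) p = dirD e' (dirD e f) p := by
  have hc := hf.contDiffAt (hΩ.mem_nhds hp)
  have hd : DifferentiableAt ℝ (fderiv ℝ f) p :=
    ContDiffOn.differentiableAt_of_isOpen hΩ (hf.fderiv_of_isOpen hΩ (m := ∞) (by simp)) hp
  have hs := (hc.isSymmSndFDerivAt (by simp; norm_cast)) e e'
  have key : ∀ w : ℝ × ℝ, fderiv ℝ (dirD w f) p = (fderiv ℝ (fderiv ℝ f) p).flip w := by
    intro w
    have := hd.hasFDerivAt.clm_apply (hasFDerivAt_const w p)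
    rw [show dirD w f = fun q => fderiv ℝ f q w from rfl, this.fderiv]
    ext <;> simp
  simp only [dirD.eq_1 e (dirD e' f), dirD.eq_1 e' (dirD e f), key]
  simpa using hs

theorem dirD_add {f g : ℝ × ℝ → F} {p : ℝ × ℝ} (hf : DifferentiableAt ℝ f p)
    (hg : DifferentiableAt ℝ g p) (e : ℝ × ℝ) :
    dirD e (fun q => f q + g q) p = dirD e f p + dirD e g p := by
  simp [dirD, fderiv_fun_add hf hg]

theorem dirD_smul {f : ℝ × ℝ → ℝ} {g : ℝ × ℝ → F} {p : ℝ × ℝ} (hf : DifferentiableAt ℝ f p)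
    (hg : DifferentiableAt ℝ g p) (e : ℝ × ℝ) :
    dirD e (fun q => f q • g q) p = f p • dirD e g p + dirD e f p • g p := by
  simp [dirD, fderiv_fun_smul hf hg]

theorem dirD_sub {f g : ℝ × ℝ → F} {p : ℝ × ℝ} (hf : DifferentiableAt ℝ f p)
    (hg : DifferentiableAt ℝ g p) (e : ℝ × ℝ) :
    dirD e (fun q => f q - g q) p = dirD e f p - dirD e g p := by
  simp [dirD, fderiv_fun_sub hf hg]

theorem dirD_neg (f : ℝ × ℝ → F) (p e : ℝ × ℝ) :
    dirD e (fun q => -f q) p = -dirD e f p := by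
  simp [dirD, fderiv_fun_neg]

theorem dirD_const (c : F) (p e : ℝ × ℝ) : dirD e (fun _ => c) p = 0 := by
  simp [dirD]

theorem dirD_mul {f g : ℝ × ℝ → ℝ} {p : ℝ × ℝ} (hf : DifferentiableAt ℝ f p)
    (hg : DifferentiableAt ℝ g p) (e : ℝ × ℝ) :
    dirD e (fun q => f q * g q) p = f p * dirD e g p + dirD e f p * g p := by
  simpa using dirD_smul hf hg e

theorem dirD_inv {f : ℝ × ℝ → ℝ} {p : ℝ × ℝ} (hf : DifferentiableAt ℝ f p) (h : f p ≠ 0)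
    (e : ℝ × ℝ) : dirD e (fun q => (f q)⁻¹) p = -dirD e f p / f p ^ 2 := by
  have := ((hasDerivAt_inv h).comp_hasFDerivAt p hf.hasFDerivAt).fderiv
  simp only [dirD]
  rw [show (fun q => (f q)⁻¹) = Inv.inv ∘ f from rfl, this]
  simp
  field_simp

theorem dirD_div {f g : ℝ × ℝ → ℝ} {p : ℝ × ℝ} (hf : DifferentiableAt ℝ f p)
    (hg : DifferentiableAt ℝ g p) (h : g p ≠ 0) (e : ℝ × ℝ) :
    dirD e (fun q => f q / g q) p = (dirD e f p * g p - f p * dirD e g p) / g p ^ 2 := by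
  simp only [div_eq_mul_inv]
  rw [dirD_mul hf (hg.fun_inv h), dirD_inv hg h]
  field_simp
  ring

theorem dirD_apply {Y : ℝ × ℝ → Fin 3 → ℝ} {p : ℝ × ℝ} (hY : DifferentiableAt ℝ Y p) (e : ℝ × ℝ)
    (i : Fin 3) : dirD e (fun q => Y q i) p = dirD e Y p i := by
  simp only [dirD]
  rw [fderiv_apply hY]
  rfl

theorem dirD_lorentz {Y Z : ℝ × ℝ → Fin 3 → ℝ} {p : ℝ × ℝ} (hY : DifferentiableAt ℝ Y p)
    (hZ : DifferentiableAt ℝ Z p) (e : ℝ × ℝ) :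
    dirD e (fun q => lorentz (Y q) (Z q)) p
      = lorentz (dirD e Y p) (Z p) + lorentz (Y p) (dirD e Z p) := by
  have hy := fun i => (differentiableAt_pi.1 hY) i
  have hz := fun i => (differentiableAt_pi.1 hZ) i
  simp only [lorentz]
  rw [dirD_sub (((hy 0).fun_mul (hz 0)).fun_add ((hy 1).fun_mul (hz 1))) ((hy 2).fun_mul (hz 2)),
    dirD_add ((hy 0).fun_mul (hz 0)) ((hy 1).fun_mul (hz 1)), dirD_mul (hy 0) (hz 0),
    dirD_mul (hy 1) (hz 1), dirD_mul (hy 2) (hz 2)]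
  simp only [dirD_apply hY, dirD_apply hZ]
  ring

theorem contDiffOn_lorentz {Y Z : ℝ × ℝ → Fin 3 → ℝ} (hY : ContDiffOn ℝ ∞ Y Ω)
    (hZ : ContDiffOn ℝ ∞ Z Ω) : ContDiffOn ℝ ∞ (fun q => lorentz (Y q) (Z q)) Ω := by
  have hy := fun i => (contDiffOn_pi.1 hY) i
  have hz := fun i => (contDiffOn_pi.1 hZ) i
  exact (((hy 0).mul (hz 0)).add ((hy 1).mul (hz 1))).sub ((hy 2).mul (hz 2))

theorem contDiffOn_lorentzCross {Y Z : ℝ × ℝ → Fin 3 → ℝ} (hY : ContDiffOn ℝ ∞ Y Ω)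
    (hZ : ContDiffOn ℝ ∞ Z Ω) : ContDiffOn ℝ ∞ (fun q => lorentzCross (Y q) (Z q)) Ω := by
  have hy := fun i => (contDiffOn_pi.1 hY) i
  have hz := fun i => (contDiffOn_pi.1 hZ) i
  refine contDiffOn_pi.2 fun i => ?_
  fin_cases i
  · exact ((hy 1).mul (hz 2)).sub ((hy 2).mul (hz 1))
  · exact ((hy 2).mul (hz 0)).sub ((hy 0).mul (hz 2))
  · exact ((hy 1).mul (hz 0)).sub ((hy 0).mul (hz 1))

theorem fderiv_eq_dirD (f : ℝ × ℝ → F) (p w : ℝ × ℝ) :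
    fderiv ℝ f p w = w.1 • dirD (1, 0) f p + w.2 • dirD (0, 1) f p := by
  rw [dirD, dirD, ← map_smul, ← map_smul, ← map_add]
  simp

/-- A function with vanishing partial derivatives on a connected open set is constant. -/
theorem exists_eq_of_dirD_eq_zero (hΩ : IsOpen Ω) (hc : IsConnected Ω) {f : ℝ × ℝ → F}
    (hf : ContDiffOn ℝ ∞ f Ω) (hu : ∀ p ∈ Ω, dirD (1, 0) f p = 0)
    (hv : ∀ p ∈ Ω, dirD (0, 1) f p = 0) : ∃ c : F, ∀ p ∈ Ω, f p = c := by
  refine hΩ.exists_is_const_of_fderiv_eq_zero hc.isPreconnected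
    (hf.differentiableOn (by simp)) fun p hp => ?_
  refine ContinuousLinearMap.ext fun w => ?_
  rw [fderiv_eq_dirD, hu p hp, hv p hp]
  simp

theorem dirD_eq_of_hasFDerivAt {f : ℝ × ℝ → F} {f' : ℝ × ℝ →L[ℝ] F} {p : ℝ × ℝ}
    (h : HasFDerivAt f f' p) (e : ℝ × ℝ) : dirD e f p = f' e := by
  rw [dirD, h.fderiv]

/-- A function that depends on `u` only near each point has vanishing `v`-derivative. -/
theorem dirD_snd_eq_zero (hΩ : IsOpen Ω) {f : ℝ × ℝ → F} {g : ℝ → F}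
    (hf : ContDiffOn ℝ ∞ f Ω) (h : ∀ p ∈ Ω, f p = g p.1) {p : ℝ × ℝ} (hp : p ∈ Ω) :
    dirD (0, 1) f p = 0 := by
  have hd := (ContDiffOn.differentiableAt_of_isOpen hΩ hf hp).hasFDerivAt
  -- Only the restriction of `f` to the vertical line through `p` matters. Near `p` that line stays
  -- in `Ω`, where `f` equals the constant `g p.1`; thus `g` needs no regularity.
  have hl : HasDerivAt (fun t : ℝ => (p.1, t)) ((0 : ℝ), (1 : ℝ)) p.2 :=
    (hasDerivAt_const _ _).prodMk (hasDerivAt_id _)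
  have h1 : HasDerivAt (fun t : ℝ => f (p.1, t)) (fderiv ℝ f p (0, 1)) p.2 :=
    HasFDerivAt.comp_hasDerivAt (f := fun t : ℝ => (p.1, t)) p.2 hd hl
  have h2 : (fun t : ℝ => f (p.1, t)) =ᶠ[nhds p.2] fun _ => g p.1 := by
    have : (fun t : ℝ => (p.1, t)) ⁻¹' Ω ∈ nhds p.2 :=
      hl.continuousAt.preimage_mem_nhds (hΩ.mem_nhds hp)
    filter_upwards [this] with t ht using h _ ht
  exact h1.unique ((hasDerivAt_const p.2 (g p.1)).congr_of_eventuallyEq h2)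

end Calculus

/-! ### Adapted frames -/

theorem lorentz_comm (x y : Fin 3 → ℝ) : lorentz x y = lorentz y x := by
  simp only [lorentz]; ring

theorem lorentz_add_left (x y z : Fin 3 → ℝ) : lorentz (x + y) z = lorentz x z + lorentz y z := by
  simp only [lorentz, Pi.add_apply]; ring

theorem lorentz_smul_left (c : ℝ) (x z : Fin 3 → ℝ) : lorentz (c • x) z = c * lorentz x z := by
  simp only [lorentz, Pi.smul_apply, smul_eq_mul]; ring

theorem lorentz_smul_right (c : ℝ) (x z : Fin 3 → ℝ) : lorentz x (c • z) = c * lorentz x z := by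
  simp only [lorentz, Pi.smul_apply, smul_eq_mul]; ring

theorem lorentz_neg_left (x z : Fin 3 → ℝ) : lorentz (-x) z = -lorentz x z := by
  simp only [lorentz, Pi.neg_apply]; ring

theorem lorentz_neg_right (x z : Fin 3 → ℝ) : lorentz x (-z) = -lorentz x z := by
  simp only [lorentz, Pi.neg_apply]; ring

theorem lorentz_cross_left (x y : Fin 3 → ℝ) : lorentz (lorentzCross x y) x = 0 := by
  simp [lorentz, lorentzCross]; ring

theorem lorentz_cross_right (x y : Fin 3 → ℝ) : lorentz (lorentzCross x y) y = 0 := by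
  simp [lorentz, lorentzCross]; ring

theorem lorentz_cross_self (x y : Fin 3 → ℝ) : lorentz (lorentzCross x y) (lorentzCross x y)
    = lorentz x y ^ 2 - lorentz x x * lorentz y y := by
  simp [lorentz, lorentzCross]; ring

/-- The vectors `x, y, n` are orthogonal with squares `E, -E, 1`. -/
structure IsLorentzFrame (E : ℝ) (x y n : Fin 3 → ℝ) : Prop where
  pos : 0 < E
  xx : lorentz x x = E
  yy : lorentz y y = -E
  nn : lorentz n n = 1
  xy : lorentz x y = 0
  nx : lorentz n x = 0
  ny : lorentz n y = 0

/-- Completeness of the rank one operators given by an orthogonal frame. -/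
theorem IsLorentzFrame.expand {E : ℝ} {x y n : Fin 3 → ℝ} (h : IsLorentzFrame E x y n)
    (w : Fin 3 → ℝ) :
    w = (lorentz w x / E) • x - (lorentz w y / E) • y + lorentz w n • n := by
  obtain ⟨hE, hxx, hyy, hnn, hxy, hnx, hny⟩ := h
  have hE' := hE.ne'
  -- The rows on the left are the covectors dual to `x, y, n`, so the orthogonality relations say
  -- that the product is the identity. A one-sided inverse of a square matrix is two-sided, and the
  -- product in the other order is the completeness relation.
  have key : !![x 0 / E, x 1 / E, -x 2 / E; -y 0 / E, -y 1 / E, y 2 / E; n 0, n 1, -n 2] *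
      !![x 0, y 0, n 0; x 1, y 1, n 1; x 2, y 2, n 2] = (1 : Matrix (Fin 3) (Fin 3) ℝ) := by
    simp only [lorentz] at *
    ext i j
    fin_cases i <;> fin_cases j <;> simp [Matrix.mul_apply, Fin.sum_univ_three] <;>
      (try field_simp) <;> linarith
  have key' := mul_eq_one_comm.1 key
  have ent : ∀ i j, _ := fun i j => congrFun (congrFun key' i) j
  have h00 := ent 0 0
  have h01 := ent 0 1
  have h02 := ent 0 2
  have h10 := ent 1 0
  have h11 := ent 1 1
  have h12 := ent 1 2
  have h20 := ent 2 0
  have h21 := ent 2 1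
  have h22 := ent 2 2
  simp [Matrix.mul_apply, Fin.sum_univ_three] at h00 h01 h02 h10 h11 h12 h20 h21 h22
  ext i
  fin_cases i <;> simp [lorentz]
  · linear_combination -w 0 * h00 - w 1 * h01 - w 2 * h02
  · linear_combination -w 0 * h10 - w 1 * h11 - w 2 * h12
  · linear_combination -w 0 * h20 - w 1 * h21 - w 2 * h22

theorem IsLorentzFrame.eq_of {E : ℝ} {x y n : Fin 3 → ℝ} (h : IsLorentzFrame E x y n)
    {w : Fin 3 → ℝ} {a b c : ℝ} (hx : lorentz w x = E * a) (hy : lorentz w y = -E * b)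
    (hn : lorentz w n = c) : w = a • x + b • y + c • n := by
  have := h.pos.ne'
  rw [h.expand w, hx, hy, hn, mul_div_cancel_left₀ _ this, neg_mul, neg_div,
    mul_div_cancel_left₀ _ this, neg_smul, sub_neg_eq_add]

/-- `X` is a surface on the open set `Ω` with unit normal field `N`, whose first fundamental form
is `E (du² - dv²)`, with `E > 0` independent of `v`, and whose mean curvature vanishes. -/
structure AdaptedFrame (Ω : Set (ℝ × ℝ)) (X N : ℝ × ℝ → Fin 3 → ℝ) : Prop where
  isOpen : IsOpen Ω
  smooth : ContDiffOn ℝ ∞ X Ω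
  smooth_normal : ContDiffOn ℝ ∞ N Ω
  frame : ∀ p ∈ Ω, IsLorentzFrame (lorentz (partialU X p) (partialU X p)) (partialU X p)
    (partialV X p) (N p)
  metric_v : ∀ p ∈ Ω, dirD (0, 1) (fun q => lorentz (partialU X q) (partialU X q)) p = 0
  zmc : ∀ p ∈ Ω, lorentz (partialV (partialV X) p) (N p) = lorentz (partialU (partialU X) p) (N p)

/-- The function `E` in the first fundamental form `E (du² - dv²)`. -/
def metricE (X : ℝ × ℝ → Fin 3 → ℝ) (p : ℝ × ℝ) : ℝ := lorentz (partialU X p) (partialU X p)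

/-- The component `⟨X_uu, N⟩` of the second fundamental form. -/
def formUU (X N : ℝ × ℝ → Fin 3 → ℝ) (p : ℝ × ℝ) : ℝ := lorentz (partialU (partialU X) p) (N p)

/-- The component `⟨X_uv, N⟩` of the second fundamental form. -/
def formUV (X N : ℝ × ℝ → Fin 3 → ℝ) (p : ℝ × ℝ) : ℝ := lorentz (partialU (partialV X) p) (N p)

/-- The logarithmic derivative of the conformal factor. -/
def metricK (X : ℝ × ℝ → Fin 3 → ℝ) (p : ℝ × ℝ) : ℝ := dirD (1, 0) (metricE X) p / (2 * metricE X p)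

namespace AdaptedFrame

variable {Ω : Set (ℝ × ℝ)} {X N : ℝ × ℝ → Fin 3 → ℝ} (h : AdaptedFrame Ω X N)
  {p : ℝ × ℝ}

include h

theorem smooth_u : ContDiffOn ℝ ∞ (partialU X) Ω := contDiffOn_dirD h.isOpen h.smooth _

theorem smooth_v : ContDiffOn ℝ ∞ (partialV X) Ω := contDiffOn_dirD h.isOpen h.smooth _

theorem smooth_metricE : ContDiffOn ℝ ∞ (metricE X) Ω := contDiffOn_lorentz h.smooth_u h.smooth_u

theorem smooth_formUU : ContDiffOn ℝ ∞ (formUU X N) Ω :=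
  contDiffOn_lorentz (contDiffOn_dirD h.isOpen h.smooth_u _) h.smooth_normal

theorem smooth_formUV : ContDiffOn ℝ ∞ (formUV X N) Ω :=
  contDiffOn_lorentz (contDiffOn_dirD h.isOpen h.smooth_v _) h.smooth_normal

theorem metricE_pos (hp : p ∈ Ω) : 0 < metricE X p := (h.frame p hp).pos

theorem smooth_metricK : ContDiffOn ℝ ∞ (metricK X) Ω :=
  (contDiffOn_dirD h.isOpen h.smooth_metricE _).div (contDiffOn_const.mul h.smooth_metricE)
    fun _ hp => by have := h.metricE_pos hp; positivity

theorem dirD_metricE (hp : p ∈ Ω) : dirD (1, 0) (metricE X) p = 2 * metricK X p * metricE X p := by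
  have := h.metricE_pos hp
  rw [metricK]; field_simp

theorem mixed (hp : p ∈ Ω) : partialV (partialU X) p = partialU (partialV X) p :=
  dirD_comm h.isOpen h.smooth _ _ hp

theorem diff {Y : ℝ × ℝ → Fin 3 → ℝ} (hY : ContDiffOn ℝ ∞ Y Ω) (hp : p ∈ Ω) :
    DifferentiableAt ℝ Y p := ContDiffOn.differentiableAt_of_isOpen h.isOpen hY hp

theorem diff_real {f : ℝ × ℝ → ℝ} (hf : ContDiffOn ℝ ∞ f Ω) (hp : p ∈ Ω) :
    DifferentiableAt ℝ f p := ContDiffOn.differentiableAt_of_isOpen h.isOpen hf hp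

/-- Differentiating a constant Lorentz product of two fields. -/
theorem lorentz_dirD {Y Z : ℝ × ℝ → Fin 3 → ℝ} {f : ℝ × ℝ → ℝ} (hY : ContDiffOn ℝ ∞ Y Ω)
    (hZ : ContDiffOn ℝ ∞ Z Ω) (hf : ∀ q ∈ Ω, lorentz (Y q) (Z q) = f q) (e : ℝ × ℝ) (hp : p ∈ Ω) :
    lorentz (dirD e Y p) (Z p) + lorentz (Y p) (dirD e Z p) = dirD e f p := by
  rw [← dirD_congr h.isOpen hf e hp, dirD_lorentz (h.diff hY hp) (h.diff hZ hp)]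

/-- This and the next five lemmas compute the Christoffel symbols: differentiate `⟨X_u, X_u⟩ = E`,
`⟨X_v, X_v⟩ = -E`, `⟨X_u, X_v⟩ = 0`, and use `E_v = 0` and `X_uv = X_vu`. -/
theorem uu_u (hp : p ∈ Ω) :
    lorentz (partialU (partialU X) p) (partialU X p) = metricE X p * metricK X p := by
  have h1 := h.lorentz_dirD h.smooth_u h.smooth_u (fun q _ => rfl) (1, 0) hp
  rw [lorentz_comm _ (dirD _ _ _)] at h1
  have h2 := h.dirD_metricE hp
  change _ = dirD (1, 0) (metricE X) p at h1
  change lorentz (dirD (1, 0) (partialU X) p) _ = _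
  linarith

theorem uv_u (hp : p ∈ Ω) : lorentz (partialU (partialV X) p) (partialU X p) = 0 := by
  have h1 := h.lorentz_dirD h.smooth_u h.smooth_u (fun q _ => rfl) (0, 1) hp
  rw [lorentz_comm _ (dirD _ _ _), h.metric_v p hp] at h1
  rw [← h.mixed hp]
  change lorentz (dirD (0, 1) (partialU X) p) _ = _
  linarith

theorem uv_v (hp : p ∈ Ω) :
    lorentz (partialU (partialV X) p) (partialV X p) = -metricE X p * metricK X p := by
  have h1 := h.lorentz_dirD h.smooth_v h.smooth_v (fun q hq => (h.frame q hq).yy) (1, 0) hp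
  rw [lorentz_comm _ (dirD _ _ _), dirD_neg] at h1
  have h2 := h.dirD_metricE hp
  change _ = -dirD (1, 0) (metricE X) p at h1
  change lorentz (dirD (1, 0) (partialV X) p) _ = _
  linarith

theorem uu_v (hp : p ∈ Ω) : lorentz (partialU (partialU X) p) (partialV X p) = 0 := by
  have h1 := h.lorentz_dirD h.smooth_u h.smooth_v (fun q hq => (h.frame q hq).xy) (1, 0) hp
  rw [dirD_const, lorentz_comm (partialU X p)] at h1
  have h2 := h.uv_u hp
  change lorentz (dirD (1, 0) (partialV X) p) _ = _ at h2
  change lorentz (dirD (1, 0) (partialU X) p) _ = _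
  linarith

theorem vv_u (hp : p ∈ Ω) :
    lorentz (partialV (partialV X) p) (partialU X p) = metricE X p * metricK X p := by
  have h1 := h.lorentz_dirD h.smooth_u h.smooth_v (fun q hq => (h.frame q hq).xy) (0, 1) hp
  rw [dirD_const, lorentz_comm (partialU X p)] at h1
  have h2 := h.uv_v hp
  rw [← h.mixed hp] at h2
  change lorentz (dirD (0, 1) (partialU X) p) _ = _ at h2
  change lorentz (dirD (0, 1) (partialV X) p) _ = _
  linarith

theorem vv_v (hp : p ∈ Ω) : lorentz (partialV (partialV X) p) (partialV X p) = 0 := by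
  have h1 := h.lorentz_dirD h.smooth_v h.smooth_v (fun q hq => (h.frame q hq).yy) (0, 1) hp
  rw [lorentz_comm _ (dirD _ _ _), dirD_neg, h.metric_v p hp] at h1
  change lorentz (dirD (0, 1) (partialV X) p) _ = _
  linarith

/-- Gauss formulas. As `E_v = 0`, every nonzero Christoffel symbol equals `κ`; with zero mean
curvature, `X_uu` and `X_vv` have the same expansion. -/
theorem partialUU (hp : p ∈ Ω) :
    partialU (partialU X) p = metricK X p • partialU X p + formUU X N p • N p := by
  have := (h.frame p hp).eq_of (w := partialU (partialU X) p) (b := 0) (h.uu_u hp)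
    (by simpa using h.uu_v hp) rfl
  rw [zero_smul, add_zero] at this
  exact this

theorem partialUV (hp : p ∈ Ω) :
    partialU (partialV X) p = metricK X p • partialV X p + formUV X N p • N p := by
  have := (h.frame p hp).eq_of (w := partialU (partialV X) p) (a := 0)
    (by simpa using h.uv_u hp) (h.uv_v hp) rfl
  rw [zero_smul, zero_add] at this
  exact this

theorem partialVV (hp : p ∈ Ω) :
    partialV (partialV X) p = metricK X p • partialU X p + formUU X N p • N p := by
  have := (h.frame p hp).eq_of (w := partialV (partialV X) p) (b := 0) (h.vv_u hp)
    (by simpa using h.vv_v hp) (h.zmc p hp)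
  rw [zero_smul, add_zero] at this
  exact this

theorem normal_normal (e : ℝ × ℝ) (hp : p ∈ Ω) : lorentz (dirD e N p) (N p) = 0 := by
  have h1 := h.lorentz_dirD h.smooth_normal h.smooth_normal (fun q hq => (h.frame q hq).nn) e hp
  rw [dirD_const, lorentz_comm (N p)] at h1
  linarith

theorem normal_u (e : ℝ × ℝ) (hp : p ∈ Ω) :
    lorentz (dirD e N p) (partialU X p) = -lorentz (dirD e (partialU X) p) (N p) := by
  have h1 := h.lorentz_dirD h.smooth_normal h.smooth_u (fun q hq => (h.frame q hq).nx) e hp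
  rw [dirD_const, lorentz_comm (N p)] at h1
  linarith

theorem normal_v (e : ℝ × ℝ) (hp : p ∈ Ω) :
    lorentz (dirD e N p) (partialV X p) = -lorentz (dirD e (partialV X) p) (N p) := by
  have h1 := h.lorentz_dirD h.smooth_normal h.smooth_v (fun q hq => (h.frame q hq).ny) e hp
  rw [dirD_const, lorentz_comm (N p)] at h1
  linarith

/-- Weingarten formulas. The derivative of `N` is tangent because `⟨N, N⟩ = 1`; the two coefficients
have opposite signs because `⟨X_v, X_v⟩ = -E`. -/
theorem dirD_normal_u (hp : p ∈ Ω) : dirD (1, 0) N p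
    = (-formUU X N p / metricE X p) • partialU X p
      + (formUV X N p / metricE X p) • partialV X p := by
  have hE := (h.metricE_pos hp).ne'
  have := (h.frame p hp).eq_of (w := dirD (1, 0) N p) (a := -formUU X N p / metricE X p)
    (b := formUV X N p / metricE X p) (c := 0)
    (by rw [h.normal_u _ hp, ← metricE, mul_div_cancel₀ _ hE]; rfl)
    (by rw [h.normal_v _ hp, ← metricE, neg_mul, mul_div_cancel₀ _ hE]; rfl)
    (h.normal_normal _ hp)
  rw [zero_smul, add_zero] at this
  exact this

theorem dirD_normal_v (hp : p ∈ Ω) : dirD (0, 1) N p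
    = (-formUV X N p / metricE X p) • partialU X p
      + (formUU X N p / metricE X p) • partialV X p := by
  have hE := (h.metricE_pos hp).ne'
  have := (h.frame p hp).eq_of (w := dirD (0, 1) N p) (a := -formUV X N p / metricE X p)
    (b := formUU X N p / metricE X p) (c := 0)
    (by rw [h.normal_u _ hp, ← metricE, mul_div_cancel₀ _ hE, formUV, ← h.mixed hp]; rfl)
    (by rw [h.normal_v _ hp, ← metricE, neg_mul, mul_div_cancel₀ _ hE, formUU, ← h.zmc p hp]; rfl)
    (h.normal_normal _ hp)
  rw [zero_smul, add_zero] at this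
  exact this

end AdaptedFrame

namespace AdaptedFrame

variable {Ω : Set (ℝ × ℝ)} {X N : ℝ × ℝ → Fin 3 → ℝ} (h : AdaptedFrame Ω X N)
  {p : ℝ × ℝ}

/-! ### The equations of Gauss and Codazzi -/

include h

theorem dirD_comb {f g : ℝ × ℝ → ℝ} {Y : ℝ × ℝ → Fin 3 → ℝ} (hf : ContDiffOn ℝ ∞ f Ω)
    (hg : ContDiffOn ℝ ∞ g Ω) (hY : ContDiffOn ℝ ∞ Y Ω) (e : ℝ × ℝ) (hp : p ∈ Ω) :
    dirD e (fun q => f q • Y q + g q • N q) p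
      = f p • dirD e Y p + dirD e f p • Y p + (g p • dirD e N p + dirD e g p • N p) := by
  have hf' := h.diff_real hf hp
  have hg' := h.diff_real hg hp
  have hY' := h.diff hY hp
  have hN' := h.diff h.smooth_normal hp
  rw [dirD_add (hf'.fun_smul hY') (hg'.fun_smul hN'), dirD_smul hf' hY', dirD_smul hg' hN']

theorem dirD_uu_uv (hp : p ∈ Ω) :
    dirD (0, 1) (partialU (partialU X)) p = dirD (1, 0) (partialU (partialV X)) p := by
  rw [← dirD_congr h.isOpen (fun q hq => h.mixed hq) (1, 0) hp]
  exact dirD_comm h.isOpen h.smooth_u _ _ hp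

theorem dirD_uv_vv (hp : p ∈ Ω) :
    dirD (0, 1) (partialU (partialV X)) p = dirD (1, 0) (partialV (partialV X)) p :=
  dirD_comm h.isOpen h.smooth_v _ _ hp

/-- The identity `X_uuv = X_uvu` written with the Gauss formulas. Its `X_u` and `X_v` components
give `metricK_v` and `gauss`. -/
theorem compat_uu_uv (hp : p ∈ Ω) :
    metricK X p • partialU (partialV X) p + dirD (0, 1) (metricK X) p • partialU X p
      + (formUU X N p • dirD (0, 1) N p + dirD (0, 1) (formUU X N) p • N p)
    = metricK X p • partialU (partialV X) p + dirD (1, 0) (metricK X) p • partialV X p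
      + (formUV X N p • dirD (1, 0) N p + dirD (1, 0) (formUV X N) p • N p) := by
  have h1 := h.dirD_uu_uv hp
  rw [dirD_congr h.isOpen (fun q hq => h.partialUU hq) (0, 1) hp,
    dirD_congr h.isOpen (fun q hq => h.partialUV hq) (1, 0) hp,
    h.dirD_comb h.smooth_metricK h.smooth_formUU h.smooth_u _ hp,
    h.dirD_comb h.smooth_metricK h.smooth_formUV h.smooth_v _ hp,
    show dirD (0, 1) (partialU X) p = _ from h.mixed hp] at h1
  exact h1

theorem compat_uv_vv (hp : p ∈ Ω) :
    metricK X p • partialV (partialV X) p + dirD (0, 1) (metricK X) p • partialV X p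
      + (formUV X N p • dirD (0, 1) N p + dirD (0, 1) (formUV X N) p • N p)
    = metricK X p • partialU (partialU X) p + dirD (1, 0) (metricK X) p • partialU X p
      + (formUU X N p • dirD (1, 0) N p + dirD (1, 0) (formUU X N) p • N p) := by
  have h1 := h.dirD_uv_vv hp
  rwa [dirD_congr h.isOpen (fun q hq => h.partialUV hq) (0, 1) hp,
    dirD_congr h.isOpen (fun q hq => h.partialVV hq) (1, 0) hp,
    h.dirD_comb h.smooth_metricK h.smooth_formUV h.smooth_v _ hp,
    h.dirD_comb h.smooth_metricK h.smooth_formUU h.smooth_u _ hp] at h1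

/-- The normal component of `X_uvv = X_vvu`. The terms in `κ` cancel because the mean curvature
vanishes. -/
theorem codazzi_right (hp : p ∈ Ω) :
    dirD (0, 1) (formUV X N) p = dirD (1, 0) (formUU X N) p := by
  have h1 := congrArg (lorentz · (N p)) (h.compat_uv_vv hp)
  have hf := h.frame p hp
  have hu := hf.nx
  have hv := hf.ny
  rw [lorentz_comm] at hu hv
  simpa [lorentz_add_left, lorentz_smul_left, hu, hv, hf.nn, h.normal_normal _ hp,
    h.zmc p hp] using h1

theorem gauss (hp : p ∈ Ω) :
    dirD (1, 0) (metricK X) p * metricE X p = formUU X N p ^ 2 - formUV X N p ^ 2 := by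
  have h1 := congrArg (lorentz · (partialV X p)) (h.compat_uu_uv hp)
  have hf := h.frame p hp
  have e1 : lorentz (dirD (0, 1) (partialV X) p) (N p) = formUU X N p := h.zmc p hp
  have e2 : lorentz (dirD (1, 0) (partialV X) p) (N p) = formUV X N p := rfl
  simp only [lorentz_add_left, lorentz_smul_left, hf.xy, hf.yy, hf.ny, h.normal_v _ hp, e1, e2]
    at h1
  rw [← metricE] at h1
  linarith

omit h in
/-- Reversing the unit normal field. -/
theorem neg (h : AdaptedFrame Ω X N) : AdaptedFrame Ω X (fun q => -N q) where
  isOpen := h.isOpen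
  smooth := h.smooth
  smooth_normal := h.smooth_normal.neg
  frame p hp := by
    obtain ⟨h1, h2, h3, h4, h5, h6, h7⟩ := h.frame p hp
    exact ⟨h1, h2, h3, by simpa [lorentz_neg_left, lorentz_neg_right] using h4, h5,
      by simpa [lorentz_neg_left] using h6, by simpa [lorentz_neg_left] using h7⟩
  metric_v := h.metric_v
  zmc p hp := by simpa [lorentz_neg_right] using h.zmc p hp

end AdaptedFrame

/-! ### Rigidity -/

/-- The form of an entry of the operator carrying the frame of one surface to the frame of another,
used to show that this operator is constant. -/
theorem dirD_transition {Ω : Set (ℝ × ℝ)} (hΩ : IsOpen Ω) {a b c d n m E : ℝ × ℝ → ℝ}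
    (ha : ContDiffOn ℝ ∞ a Ω) (hb : ContDiffOn ℝ ∞ b Ω) (hc : ContDiffOn ℝ ∞ c Ω)
    (hd : ContDiffOn ℝ ∞ d Ω) (hn : ContDiffOn ℝ ∞ n Ω) (hm : ContDiffOn ℝ ∞ m Ω)
    (hE : ContDiffOn ℝ ∞ E Ω) {p : ℝ × ℝ} (hp : p ∈ Ω) (h0 : E p ≠ 0) (e : ℝ × ℝ) :
    dirD e (fun q => (a q * b q - c q * d q) / E q + n q * m q) p
      = ((a p * dirD e b p + dirD e a p * b p - (c p * dirD e d p + dirD e c p * d p)) * E p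
          - (a p * b p - c p * d p) * dirD e E p) / E p ^ 2
        + (n p * dirD e m p + dirD e n p * m p) := by
  replace ha := ha.differentiableAt_of_isOpen hΩ hp
  replace hb := hb.differentiableAt_of_isOpen hΩ hp
  replace hc := hc.differentiableAt_of_isOpen hΩ hp
  replace hd := hd.differentiableAt_of_isOpen hΩ hp
  replace hn := hn.differentiableAt_of_isOpen hΩ hp
  replace hm := hm.differentiableAt_of_isOpen hΩ hp
  replace hE := hE.differentiableAt_of_isOpen hΩ hp
  have hab := ha.fun_mul hb
  have hcd := hc.fun_mul hd
  have hq := hab.fun_sub hcd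
  have hqE : DifferentiableAt ℝ (fun q => (a q * b q - c q * d q) / E q) p := by
    simpa only [div_eq_mul_inv] using hq.fun_mul (hE.fun_inv h0)
  rw [dirD_add hqE (hn.fun_mul hm), dirD_div hq hE h0, dirD_sub hab hcd,
    dirD_mul ha hb, dirD_mul hc hd, dirD_mul hn hm]

/-- Two surfaces with the same first and second fundamental forms on a connected open set
differ by an isometry. -/
theorem AdaptedFrame.exists_isometry {Ω : Set (ℝ × ℝ)} {X N Y M : ℝ × ℝ → Fin 3 → ℝ}
    (hX : AdaptedFrame Ω X N) (hY : AdaptedFrame Ω Y M) (hΩ : IsConnected Ω)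
    (hE : ∀ p ∈ Ω, metricE X p = metricE Y p) (he : ∀ p ∈ Ω, formUU X N p = formUU Y M p)
    (hf : ∀ p ∈ Ω, formUV X N p = formUV Y M p) :
    ∃ Φ : (Fin 3 → ℝ) → (Fin 3 → ℝ), IsLorentzIsometry Φ ∧ ∀ p ∈ Ω, X p = Φ (Y p) := by
  have hk : ∀ p ∈ Ω, metricK X p = metricK Y p := fun p hp => by
    rw [metricK, metricK, hE p hp, dirD_congr hX.isOpen hE _ hp]
  have cpt : ∀ {Z : ℝ × ℝ → Fin 3 → ℝ}, ContDiffOn ℝ ∞ Z Ω → ∀ i,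
      ContDiffOn ℝ ∞ (fun q => Z q i) Ω := fun hZ i => contDiffOn_pi.1 hZ i
  -- These are the entries of `(X_u Y_uᵀ - X_v Y_vᵀ) / E + N Mᵀ`. Both frames satisfy the same
  -- linear system by the Gauss and Weingarten formulas, and its coefficients are compatible with
  -- the metric, so all derivatives cancel.
  have key : ∀ i j, ∃ c : ℝ, ∀ p ∈ Ω, (partialU X p i * partialU Y p j -
      partialV X p i * partialV Y p j) / metricE X p + N p i * M p j = c := by
    intro i j
    have s1 := cpt hX.smooth_u i
    have s2 := cpt hY.smooth_u j
    have s3 := cpt hX.smooth_v i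
    have s4 := cpt hY.smooth_v j
    have s5 := cpt hX.smooth_normal i
    have s6 := cpt hY.smooth_normal j
    have s7 := hX.smooth_metricE
    refine exists_eq_of_dirD_eq_zero hX.isOpen hΩ ?_ ?_ ?_
    · exact (((s1.mul s2).sub (s3.mul s4)).div s7 fun p hp => (hX.metricE_pos hp).ne').add
        (s5.mul s6)
    all_goals
      intro p hp
      have h0 := (hX.metricE_pos hp).ne'
      rw [dirD_transition hX.isOpen s1 s2 s3 s4 s5 s6 s7 hp h0,
        dirD_apply (hX.diff hX.smooth_u hp), dirD_apply (hX.diff hX.smooth_v hp),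
        dirD_apply (hX.diff hX.smooth_normal hp), dirD_apply (hY.diff hY.smooth_u hp),
        dirD_apply (hY.diff hY.smooth_v hp), dirD_apply (hY.diff hY.smooth_normal hp)]
    · rw [hX.dirD_metricE hp, hX.dirD_normal_u hp, hY.dirD_normal_u hp,
        show dirD (1, 0) (partialU X) p = _ from hX.partialUU hp,
        show dirD (1, 0) (partialU Y) p = _ from hY.partialUU hp,
        show dirD (1, 0) (partialV X) p = _ from hX.partialUV hp,
        show dirD (1, 0) (partialV Y) p = _ from hY.partialUV hp,
        ← hE p hp, ← he p hp, ← hf p hp, ← hk p hp]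
      simp only [Pi.add_apply, Pi.smul_apply, smul_eq_mul]
      field_simp
      ring
    · rw [show dirD (0, 1) (metricE X) p = 0 from hX.metric_v p hp, hX.dirD_normal_v hp,
        hY.dirD_normal_v hp,
        show dirD (0, 1) (partialU X) p = _ from (hX.mixed hp).trans (hX.partialUV hp),
        show dirD (0, 1) (partialU Y) p = _ from (hY.mixed hp).trans (hY.partialUV hp),
        show dirD (0, 1) (partialV X) p = _ from hX.partialVV hp,
        show dirD (0, 1) (partialV Y) p = _ from hY.partialVV hp,
        ← hE p hp, ← he p hp, ← hf p hp, ← hk p hp]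
      simp only [Pi.add_apply, Pi.smul_apply, smul_eq_mul]
      field_simp
      ring
  choose T hT using key
  obtain ⟨p₀, hp₀⟩ := hΩ.nonempty
  -- The minus sign in the last column turns Euclidean pairing with `Y_u, Y_v, M` into Lorentzian
  -- pairing.
  set L : Matrix (Fin 3) (Fin 3) ℝ :=
    !![T 0 0, T 0 1, -T 0 2; T 1 0, T 1 1, -T 1 2; T 2 0, T 2 1, -T 2 2] with hL
  have hLw : ∀ p ∈ Ω, ∀ w, L *ᵥ w = (lorentz w (partialU Y p) / metricE X p) • partialU X p
      - (lorentz w (partialV Y p) / metricE X p) • partialV X p + lorentz w (M p) • N p := by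
    intro p hp w
    have h0 := (hX.metricE_pos hp).ne'
    ext i
    fin_cases i <;>
      simp [hL, Matrix.mulVec, dotProduct, Fin.sum_univ_three, ← hT _ _ p hp, lorentz] <;> ring
  -- `L` does not depend on the point, so it suffices to compare the frames at `p₀`.
  have hiso : ∀ x y, lorentz (L *ᵥ x) (L *ᵥ y) = lorentz x y := by
    intro x y
    have hfX := hX.frame p₀ hp₀
    have hfY := hY.frame p₀ hp₀
    have h0 := (hX.metricE_pos hp₀).ne'
    have hy := congrArg (lorentz x) (hfY.expand y)
    rw [← metricE, ← hE p₀ hp₀] at hy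
    have a1 : lorentz (partialU X p₀) (partialU X p₀) = metricE X p₀ := rfl
    have a2 := hfX.yy
    have a3 := hfX.nn
    have a4 := hfX.xy
    have a5 := hfX.nx
    have a6 := hfX.ny
    rw [a1] at a2
    rw [hy, hLw p₀ hp₀ x, hLw p₀ hp₀ y]
    generalize partialU X p₀ = xu at *
    generalize partialV X p₀ = xv at *
    generalize N p₀ = n at *
    have e1 : ∀ a b c a' b' c' : ℝ, lorentz (a • xu - b • xv + c • n) (a' • xu - b' • xv + c' • n)
        = a * a' * lorentz xu xu + b * b' * lorentz xv xv + c * c' * lorentz n n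
          - (a * b' + b * a') * lorentz xu xv + (a * c' + c * a') * lorentz n xu
          - (b * c' + c * b') * lorentz n xv := by
      intros
      simp only [lorentz, Pi.add_apply, Pi.sub_apply, Pi.smul_apply, smul_eq_mul]; ring
    have e2 : ∀ (a b c : ℝ) (r s t : Fin 3 → ℝ), lorentz x (a • r - b • s + c • t)
        = a * lorentz x r - b * lorentz x s + c * lorentz x t := by
      intros
      simp only [lorentz, Pi.add_apply, Pi.sub_apply, Pi.smul_apply, smul_eq_mul]; ring
    rw [e1, e2, a1, a2, a3, a4, a5, a6]
    field_simp
    ring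
  have hLu : ∀ p ∈ Ω, L *ᵥ partialU Y p = partialU X p := by
    intro p hp
    have hfY := hY.frame p hp
    have h0 := (hX.metricE_pos hp).ne'
    rw [hLw p hp, hfY.xy, lorentz_comm _ (M p), hfY.nx, hfY.xx, ← metricE, ← hE p hp, div_self h0]
    simp
  have hLv : ∀ p ∈ Ω, L *ᵥ partialV Y p = partialV X p := by
    intro p hp
    have hfY := hY.frame p hp
    have h0 := (hX.metricE_pos hp).ne'
    rw [hLw p hp, lorentz_comm _ (partialU Y p), hfY.xy, lorentz_comm _ (M p), hfY.ny, hfY.yy,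
      ← metricE, ← hE p hp, neg_div, div_self h0]
    simp
  set A : (Fin 3 → ℝ) →L[ℝ] (Fin 3 → ℝ) := LinearMap.toContinuousLinearMap L.mulVecLin with hA
  have hAw : ∀ w, A w = L *ᵥ w := fun w => rfl
  have hAY : ContDiffOn ℝ ∞ (fun q => A (Y q)) Ω := A.contDiff.comp_contDiffOn hY.smooth
  have hdA : ∀ p ∈ Ω, ∀ e, dirD e (fun q => A (Y q)) p = L *ᵥ dirD e Y p := by
    intro p hp e
    exact dirD_eq_of_hasFDerivAt (A.hasFDerivAt.comp p (hY.diff hY.smooth hp).hasFDerivAt) e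
  -- Since `L` carries `Y_u, Y_v` to `X_u, X_v`, the difference `X - L Y` is a constant: the
  -- translation part.
  obtain ⟨w, hw⟩ : ∃ w, ∀ p ∈ Ω, X p - A (Y p) = w := by
    refine exists_eq_of_dirD_eq_zero hX.isOpen hΩ (hX.smooth.sub hAY) ?_ ?_
    · intro p hp
      rw [dirD_sub (hX.diff hX.smooth hp) (hX.diff hAY hp), hdA p hp, sub_eq_zero]
      exact (hLu p hp).symm
    · intro p hp
      rw [dirD_sub (hX.diff hX.smooth hp) (hX.diff hAY hp), hdA p hp, sub_eq_zero]
      exact (hLv p hp).symm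
  refine ⟨fun x => L *ᵥ x + w, ⟨L, w, hiso, fun _ => rfl⟩, fun p hp => ?_⟩
  rw [← hw p hp, hAw]
  simp

/-! ### Integration of the Gauss and Codazzi equations -/

theorem dirD_comp_fst {g : ℝ → ℝ} {g' : ℝ} {p : ℝ × ℝ} (hg : HasDerivAt g g' p.1) (e : ℝ × ℝ) :
    dirD e (fun q => g q.1) p = g' * e.1 := by
  rw [dirD_eq_of_hasFDerivAt (f := fun q : ℝ × ℝ => g q.1) (hg.comp_hasFDerivAt p hasFDerivAt_fst)]
  simp

theorem dirD_comp_snd {g : ℝ → ℝ} {g' : ℝ} {p : ℝ × ℝ} (hg : HasDerivAt g g' p.2) (e : ℝ × ℝ) :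
    dirD e (fun q => g q.2) p = g' * e.2 := by
  rw [dirD_eq_of_hasFDerivAt (f := fun q : ℝ × ℝ => g q.2) (hg.comp_hasFDerivAt p hasFDerivAt_snd)]
  simp

theorem hasDerivAt_exp_mul (c x : ℝ) :
    HasDerivAt (fun t => Real.exp (c * t)) (c * Real.exp (c * x)) x := by
  simpa [mul_comm] using ((hasDerivAt_id x).const_mul c).exp

theorem hasDerivAt_cosh_mul (c x : ℝ) :
    HasDerivAt (fun t => Real.cosh (c * t)) (c * Real.sinh (c * x)) x := by
  simpa [mul_comm] using ((hasDerivAt_id x).const_mul c).cosh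

theorem hasDerivAt_sinh_mul (c x : ℝ) :
    HasDerivAt (fun t => Real.sinh (c * t)) (c * Real.cosh (c * x)) x := by
  simpa [mul_comm] using ((hasDerivAt_id x).const_mul c).sinh

/-- The square of the conformal factor of the explicit surfaces. -/
def modelE (a A B u : ℝ) : ℝ :=
  Real.exp (4 * a * u) * (A ^ 2 * Real.exp (2 * B * u) + 1) ^ 2 /
    (4 * A ^ 2 * B ^ 2 * Real.exp (2 * B * u))

/-- The first relation gives `κ = B (x - 1) / (x + 1)`, so `B² - κ² = 4 B² x / (x + 1)²`, which the
second equates with `H² / E`. It is applied to `κ - 2a` in place of `κ`. -/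
theorem eq_of_mobius {B κ x H E : ℝ} (hB : 0 < B) (hx : 0 < x) (hE : E ≠ 0)
    (h1 : B + κ = x * (B - κ)) (h2 : κ ^ 2 + H ^ 2 / E = B ^ 2) :
    E = H ^ 2 * (x + 1) ^ 2 / (4 * B ^ 2 * x) := by
  have h3 : κ = B * (x - 1) / (x + 1) := by
    field_simp
    linarith
  rw [h3] at h2
  field_simp at h2 ⊢
  linear_combination (-1) * h2

namespace AdaptedFrame

variable {Ω : Set (ℝ × ℝ)} {X N : ℝ × ℝ → Fin 3 → ℝ} (h : AdaptedFrame Ω X N)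
  {p : ℝ × ℝ}

include h

/-- In the `X_u` component of `X_uuv = X_uvu` the contributions of the second fundamental form are
both `-ef` and cancel, leaving `κ_v E = 0`. -/
theorem metricK_v (hp : p ∈ Ω) : dirD (0, 1) (metricK X) p = 0 := by
  have h1 := congrArg (lorentz · (partialU X p)) (h.compat_uu_uv hp)
  have hf := h.frame p hp
  have hyx := hf.xy
  rw [lorentz_comm] at hyx
  have e1 : lorentz (dirD (0, 1) (partialU X) p) (N p) = formUV X N p := by
    rw [formUV, ← h.mixed hp]; rfl
  have e2 : lorentz (dirD (1, 0) (partialU X) p) (N p) = formUU X N p := rfl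
  simp only [lorentz_add_left, lorentz_smul_left, hyx, hf.nx, h.normal_u _ hp, e1, e2]
    at h1
  rw [← metricE] at h1
  have : dirD (0, 1) (metricK X) p * metricE X p = 0 := by linarith
  exact (mul_eq_zero.1 this).resolve_right (h.metricE_pos hp).ne'

/-- The fundamental forms of a surface with zero mean curvature and linear twist. -/
theorem forms_eq (hc : IsConnected Ω) {a : ℝ} {H : ℝ × ℝ → ℝ}
    (hH : ContDiffOn ℝ ∞ H Ω) (hHv : ∀ p ∈ Ω, dirD (0, 1) H p = 0)
    (he : ∀ p ∈ Ω, formUU X N p = H p * Real.cosh (2 * a * p.2))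
    (hf : ∀ p ∈ Ω, formUV X N p = H p * Real.sinh (2 * a * p.2))
    (hne : ∃ p ∈ Ω, H p ≠ 0) :
    ∃ C A B : ℝ, C ≠ 0 ∧ 0 < A ∧ 0 < B ∧ (∀ p ∈ Ω, H p = C * Real.exp (2 * a * p.1)) ∧
      ∀ p ∈ Ω, metricE X p = C ^ 2 * modelE a A B p.1 := by
  -- The Codazzi equation reads `2a H cosh (2av) = H_u cosh (2av)`.
  have hHu : ∀ p ∈ Ω, dirD (1, 0) H p = 2 * a * H p := by
    intro p hp
    have h1 := h.codazzi_right hp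
    have hd := h.diff_real hH hp
    rw [dirD_congr h.isOpen hf _ hp, dirD_congr h.isOpen he _ hp,
      dirD_mul hd (by fun_prop), dirD_mul hd (by fun_prop), hHv p hp,
      dirD_comp_snd (hasDerivAt_sinh_mul (2 * a) p.2),
      dirD_comp_snd (hasDerivAt_cosh_mul (2 * a) p.2)] at h1
    have h2 := Real.cosh_pos (2 * a * p.2)
    apply mul_right_cancel₀ h2.ne'
    linarith
  obtain ⟨C, hC⟩ : ∃ C, ∀ p ∈ Ω, H p * Real.exp (-(2 * a) * p.1) = C := by
    refine exists_eq_of_dirD_eq_zero h.isOpen hc (hH.mul (by fun_prop)) ?_ ?_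
    all_goals
      intro p hp
      rw [dirD_mul (h.diff_real hH hp) (by fun_prop),
        dirD_comp_fst (hasDerivAt_exp_mul (-(2 * a)) p.1)]
    · rw [hHu p hp]; ring
    · rw [hHv p hp]; ring
  have hHC : ∀ p ∈ Ω, H p = C * Real.exp (2 * a * p.1) := by
    intro p hp
    rw [← hC p hp, mul_assoc, ← Real.exp_add]
    simp
  have hC0 : C ≠ 0 := by
    rintro rfl
    obtain ⟨p, hp, hpn⟩ := hne
    exact hpn (by simp [hHC p hp])
  have hH0 : ∀ p ∈ Ω, H p ≠ 0 := fun p hp => by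
    rw [hHC p hp]; exact mul_ne_zero hC0 (Real.exp_pos _).ne'
  -- The Gauss equation, where `e² - f² = H²` no longer involves `v`.
  have hku : ∀ p ∈ Ω, dirD (1, 0) (metricK X) p = H p ^ 2 / metricE X p := by
    intro p hp
    rw [eq_div_iff (h.metricE_pos hp).ne', h.gauss hp, he p hp, hf p hp]
    have := Real.cosh_sq (2 * a * p.2)
    rw [mul_pow, mul_pow, this]; ring
  have smK := h.smooth_metricK
  have smE := h.smooth_metricE
  -- First integral: `H² / E` has `u`-derivative `(4a - 2κ) H² / E`, opposite to that of `(κ -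
  -- 2a)²`.
  obtain ⟨S, hS⟩ : ∃ S, ∀ p ∈ Ω, (metricK X p - 2 * a) * (metricK X p - 2 * a)
      + H p * H p / metricE X p = S := by
    refine exists_eq_of_dirD_eq_zero h.isOpen hc
      (((smK.sub contDiffOn_const).mul (smK.sub contDiffOn_const)).add
        ((hH.mul hH).div smE fun p hp => (h.metricE_pos hp).ne')) ?_ ?_
    all_goals
      intro p hp
      have h0 := (h.metricE_pos hp).ne'
      have d1 := h.diff_real smK hp
      have d2 := h.diff_real smE hp
      have d3 := h.diff_real hH hp
      have d4 : DifferentiableAt ℝ (fun q => H q * H q / metricE X q) p := by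
        simpa only [div_eq_mul_inv] using (d3.fun_mul d3).fun_mul (d2.fun_inv h0)
      rw [dirD_add (by fun_prop) d4, dirD_mul (by fun_prop) (by fun_prop),
        dirD_sub d1 (by fun_prop), dirD_const, dirD_div (d3.fun_mul d3) d2 h0, dirD_mul d3 d3]
    · rw [hHu p hp, hku p hp, h.dirD_metricE hp]
      field_simp
      ring
    · rw [hHv p hp, h.metricK_v hp, show dirD (0, 1) (metricE X) p = 0 from h.metric_v p hp]
      simp
  have hq : ∀ p ∈ Ω, 0 < H p * H p / metricE X p := fun p hp =>
    div_pos (mul_self_pos.2 (hH0 p hp)) (h.metricE_pos hp)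
  obtain ⟨p₀, hp₀⟩ := hc.nonempty
  have hS0 : 0 < S := by
    rw [← hS p₀ hp₀]
    exact add_pos_of_nonneg_of_pos (mul_self_nonneg _) (hq p₀ hp₀)
  obtain ⟨B, hB, rfl⟩ : ∃ B, 0 < B ∧ B ^ 2 = S := ⟨√S, Real.sqrt_pos.2 hS0, Real.sq_sqrt hS0.le⟩
  -- Strict because `H² / E > 0`; hence the quotient below is defined and positive, and its constant
  -- can be written `A²`.
  have hlt : ∀ p ∈ Ω, -B < metricK X p - 2 * a ∧ metricK X p - 2 * a < B := fun p hp =>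
    abs_lt_of_sq_lt_sq' (by have := hS p hp; have := hq p hp; nlinarith) hB.le
  obtain ⟨R, hR⟩ : ∃ R, ∀ p ∈ Ω, (B + (metricK X p - 2 * a)) / (B - (metricK X p - 2 * a))
      * Real.exp (-(2 * B) * p.1) = R := by
    have hne' : ∀ p ∈ Ω, B - (metricK X p - 2 * a) ≠ 0 := fun p hp => by
      linarith [(hlt p hp).2]
    refine exists_eq_of_dirD_eq_zero h.isOpen hc
      (((contDiffOn_const.add (smK.sub contDiffOn_const)).div
        (contDiffOn_const.sub (smK.sub contDiffOn_const)) hne').mul (by fun_prop)) ?_ ?_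
    all_goals
      intro p hp
      have h0 := hne' p hp
      have d1 := h.diff_real smK hp
      have d3 : DifferentiableAt ℝ (fun q => metricK X q - 2 * a) p := by fun_prop
      have d4 : DifferentiableAt ℝ (fun q => B + (metricK X q - 2 * a)) p := by fun_prop
      have d5 : DifferentiableAt ℝ (fun q => B - (metricK X q - 2 * a)) p := by fun_prop
      have d6 : DifferentiableAt ℝ (fun q => (B + (metricK X q - 2 * a)) /
          (B - (metricK X q - 2 * a))) p := by
        simpa only [div_eq_mul_inv] using d4.fun_mul (d5.fun_inv h0)
      rw [dirD_mul d6 (by fun_prop), dirD_div d4 d5 h0, dirD_add (by fun_prop) d3,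
        dirD_sub (by fun_prop) d3, dirD_sub d1 (by fun_prop), dirD_const, dirD_const,
        dirD_comp_fst (hasDerivAt_exp_mul (-(2 * B)) p.1)]
    · have e1 : H p ^ 2 / metricE X p = B ^ 2 - (metricK X p - 2 * a) ^ 2 := by
        rw [← hS p hp]; ring
      rw [hku p hp, e1]
      field_simp
      ring
    · rw [h.metricK_v hp]
      simp
  have hR0 : 0 < R := by
    rw [← hR p₀ hp₀]
    have := hlt p₀ hp₀
    exact mul_pos (div_pos (by linarith) (by linarith)) (Real.exp_pos _)
  obtain ⟨A, hA, rfl⟩ : ∃ A, 0 < A ∧ A ^ 2 = R := ⟨√R, Real.sqrt_pos.2 hR0, Real.sq_sqrt hR0.le⟩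
  refine ⟨C, A, B, hC0, hA, hB, hHC, fun p hp => ?_⟩
  have hx : 0 < A ^ 2 * Real.exp (2 * B * p.1) := by positivity
  have hlt' := hlt p hp
  have h1 : B + (metricK X p - 2 * a)
      = A ^ 2 * Real.exp (2 * B * p.1) * (B - (metricK X p - 2 * a)) := by
    have h2 : Real.exp (-(2 * B) * p.1) * Real.exp (2 * B * p.1) = 1 := by
      rw [← Real.exp_add]; simp
    have h3 : B - (metricK X p - 2 * a) ≠ 0 := by linarith
    rw [← hR p hp, mul_assoc _ _ (Real.exp (2 * B * p.1)), h2, mul_one, div_mul_cancel₀ _ h3]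
  rw [eq_of_mobius (H := H p) hB hx (h.metricE_pos hp).ne' h1 (by rw [← hS p hp]; ring), hHC p hp, modelE,
    show 4 * a * p.1 = 2 * a * p.1 + 2 * a * p.1 by ring, Real.exp_add]
  field_simp

end AdaptedFrame

/-! ### Surfaces with diagonal first fundamental form -/

theorem unitNormal_eq {X : ℝ × ℝ → Fin 3 → ℝ} {p : ℝ × ℝ} (h0 : 0 < metricE X p)
    (hv : lorentz (partialV X p) (partialV X p) = -metricE X p)
    (huv : lorentz (partialU X p) (partialV X p) = 0) :
    unitNormal X p = (metricE X p)⁻¹ • lorentzCross (partialU X p) (partialV X p) := by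
  rw [unitNormal, lorentz_cross_self, huv, hv, ← metricE]
  congr 2
  rw [show (0 : ℝ) ^ 2 - metricE X p * -metricE X p = metricE X p ^ 2 by ring,
    abs_of_nonneg (sq_nonneg _), Real.sqrt_sq h0.le]

theorem AdaptedFrame.of_unitNormal {Ω : Set (ℝ × ℝ)} {X : ℝ × ℝ → Fin 3 → ℝ} (hΩ : IsOpen Ω)
    (hX : ContDiffOn ℝ ∞ X Ω) (h0 : ∀ p ∈ Ω, 0 < metricE X p)
    (hv : ∀ p ∈ Ω, lorentz (partialV X p) (partialV X p) = -metricE X p)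
    (huv : ∀ p ∈ Ω, lorentz (partialU X p) (partialV X p) = 0)
    (hEv : ∀ p ∈ Ω, dirD (0, 1) (metricE X) p = 0)
    (hz : ∀ p ∈ Ω, lorentz (partialV (partialV X) p) (unitNormal X p)
      = lorentz (partialU (partialU X) p) (unitNormal X p)) :
    AdaptedFrame Ω X (unitNormal X) where
  isOpen := hΩ
  smooth := hX
  smooth_normal := by
    have su := contDiffOn_dirD hΩ hX (1, 0)
    have sv := contDiffOn_dirD hΩ hX (0, 1)
    have sE : ContDiffOn ℝ ∞ (metricE X) Ω := contDiffOn_lorentz su su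
    exact ((sE.inv fun p hp => (h0 p hp).ne').smul (contDiffOn_lorentzCross su sv)).congr
      fun p hp => unitNormal_eq (h0 p hp) (hv p hp) (huv p hp)
  frame p hp := by
    have hE := h0 p hp
    have hN := unitNormal_eq hE (hv p hp) (huv p hp)
    refine ⟨hE, rfl, hv p hp, ?_, huv p hp, ?_, ?_⟩
    · rw [hN, lorentz_smul_left, lorentz_smul_right, lorentz_cross_self, hv p hp, huv p hp,
        ← metricE]
      field_simp
      ring
    · rw [hN, lorentz_smul_left, lorentz_cross_left, mul_zero]
    · rw [hN, lorentz_smul_left, lorentz_cross_right, mul_zero]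
  metric_v := hEv
  zmc := hz

/-! ### Effect of translations of the parameters and of homotheties -/

theorem dirD_translate {F : Type*} [NormedAddCommGroup F] [NormedSpace ℝ F] (f : ℝ × ℝ → F)
    (τ e p : ℝ × ℝ) : dirD e (fun q => f (q + τ)) p = dirD e f (p + τ) := by
  rw [dirD, dirD, fderiv_comp_add_right]

theorem AdaptedFrame.translate {X N : ℝ × ℝ → Fin 3 → ℝ} (h : AdaptedFrame Set.univ X N)
    (τ : ℝ × ℝ) : AdaptedFrame Set.univ (fun q => X (q + τ)) (fun q => N (q + τ)) := by
  have hu : partialU (fun q => X (q + τ)) = fun q => partialU X (q + τ) :=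
    funext (dirD_translate X τ (1, 0))
  have hv : partialV (fun q => X (q + τ)) = fun q => partialV X (q + τ) :=
    funext (dirD_translate X τ (0, 1))
  have sm : ∀ {f : ℝ × ℝ → Fin 3 → ℝ}, ContDiffOn ℝ ∞ f Set.univ →
      ContDiffOn ℝ ∞ (fun q => f (q + τ)) Set.univ := fun hf =>
    ((contDiffOn_univ.1 hf).comp (contDiff_id.add contDiff_const)).contDiffOn
  refine ⟨h.isOpen, sm h.smooth, sm h.smooth_normal, fun p _ => ?_, fun p _ => ?_, fun p _ => ?_⟩
  · rw [hu, hv]; exact h.frame (p + τ) trivial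
  · rw [hu, dirD_translate fun q => lorentz (partialU X q) (partialU X q)]
    exact h.metric_v (p + τ) trivial
  · rw [hu, hv]
    exact ((congrArg (lorentz · _) (dirD_translate (partialV X) τ (0, 1) p)).trans
      (h.zmc (p + τ) trivial)).trans
      (congrArg (lorentz · _) (dirD_translate (partialU X) τ (1, 0) p)).symm

theorem metricE_translate (X : ℝ × ℝ → Fin 3 → ℝ) (τ p : ℝ × ℝ) :
    metricE (fun q => X (q + τ)) p = metricE X (p + τ) := by
  simp only [metricE, partialU, ← dirD.eq_1, dirD_translate]

theorem formUU_translate (X N : ℝ × ℝ → Fin 3 → ℝ) (τ p : ℝ × ℝ) :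
    formUU (fun q => X (q + τ)) (fun q => N (q + τ)) p = formUU X N (p + τ) := by
  have hu : partialU (fun q => X (q + τ)) = fun q => partialU X (q + τ) :=
    funext (dirD_translate X τ (1, 0))
  rw [formUU, hu]
  exact congrArg (lorentz · _) (dirD_translate _ τ (1, 0) p)

theorem formUV_translate (X N : ℝ × ℝ → Fin 3 → ℝ) (τ p : ℝ × ℝ) :
    formUV (fun q => X (q + τ)) (fun q => N (q + τ)) p = formUV X N (p + τ) := by
  have hu : partialV (fun q => X (q + τ)) = fun q => partialV X (q + τ) :=
    funext (dirD_translate X τ (0, 1))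
  rw [formUV, hu]
  exact congrArg (lorentz · _) (dirD_translate _ τ (1, 0) p)

theorem dirD_const_smul {F : Type*} [NormedAddCommGroup F] [NormedSpace ℝ F] (f : ℝ × ℝ → F)
    (c : ℝ) (e p : ℝ × ℝ) : dirD e (fun q => c • f q) p = c • dirD e f p := by
  rw [dirD, show (fun q => c • f q) = c • f from rfl, fderiv_const_smul_field]
  rfl

theorem partialU_const_smul (X : ℝ × ℝ → Fin 3 → ℝ) (c : ℝ) :
    partialU (fun q => c • X q) = fun q => c • partialU X q :=
  funext (dirD_const_smul X c (1, 0))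

theorem partialV_const_smul (X : ℝ × ℝ → Fin 3 → ℝ) (c : ℝ) :
    partialV (fun q => c • X q) = fun q => c • partialV X q :=
  funext (dirD_const_smul X c (0, 1))

theorem metricE_const_smul (X : ℝ × ℝ → Fin 3 → ℝ) (c : ℝ) (p : ℝ × ℝ) :
    metricE (fun q => c • X q) p = c ^ 2 * metricE X p := by
  rw [metricE, partialU_const_smul, lorentz_smul_left, lorentz_smul_right, metricE]
  ring

theorem formUU_const_smul (X N : ℝ × ℝ → Fin 3 → ℝ) (c : ℝ) (p : ℝ × ℝ) :
    formUU (fun q => c • X q) N p = c * formUU X N p := by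
  rw [formUU, partialU_const_smul, partialU_const_smul, lorentz_smul_left, formUU]

theorem formUV_const_smul (X N : ℝ × ℝ → Fin 3 → ℝ) (c : ℝ) (p : ℝ × ℝ) :
    formUV (fun q => c • X q) N p = c * formUV X N p := by
  rw [formUV, partialV_const_smul, partialU_const_smul, lorentz_smul_left, formUV]

theorem AdaptedFrame.const_smul {Ω : Set (ℝ × ℝ)} {X N : ℝ × ℝ → Fin 3 → ℝ}
    (h : AdaptedFrame Ω X N) {c : ℝ} (hc : 0 < c) : AdaptedFrame Ω (fun q => c • X q) N where
  isOpen := h.isOpen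
  smooth := h.smooth.const_smul c
  smooth_normal := h.smooth_normal
  frame p hp := by
    obtain ⟨h1, h2, h3, h4, h5, h6, h7⟩ := h.frame p hp
    simp only [partialU_const_smul, partialV_const_smul]
    refine ⟨?_, rfl, ?_, h4, ?_, ?_, ?_⟩ <;>
      simp only [lorentz_smul_left, lorentz_smul_right, h3, h5, h6, h7] <;>
      first | positivity | ring
  metric_v p hp := by
    have := dirD_const_smul (fun q => lorentz (partialU X q) (partialU X q)) (c * c) (0, 1) p
    rw [h.metric_v p hp] at this
    simpa only [partialU_const_smul, lorentz_smul_left, lorentz_smul_right, smul_eq_mul,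
      mul_assoc, mul_zero] using this
  zmc p hp := by
    rw [partialU_const_smul, partialV_const_smul, partialU_const_smul, partialV_const_smul,
      lorentz_smul_left, lorentz_smul_left, h.zmc p hp]

theorem AdaptedFrame.mono {Ω Ω' : Set (ℝ × ℝ)} {X N : ℝ × ℝ → Fin 3 → ℝ}
    (h : AdaptedFrame Ω X N) (ho : IsOpen Ω') (hs : Ω' ⊆ Ω) : AdaptedFrame Ω' X N :=
  ⟨ho, h.smooth.mono hs, h.smooth_normal.mono hs, fun p hp => h.frame p (hs hp),
    fun p hp => h.metric_v p (hs hp), fun p hp => h.zmc p (hs hp)⟩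

/-! ### The explicit surfaces -/

/-- The real part of `e^{c(u + jv)}`, with `j² = 1`. -/
def expC (c : ℝ) (p : ℝ × ℝ) : ℝ := Real.exp (c * p.1) * Real.cosh (c * p.2)

/-- The imaginary part of `e^{c(u + jv)}`, with `j² = 1`. -/
def expS (c : ℝ) (p : ℝ × ℝ) : ℝ := Real.exp (c * p.1) * Real.sinh (c * p.2)

open Classical in
/-- A primitive of `expC`. -/
def primC (c : ℝ) (p : ℝ × ℝ) : ℝ := if c = 0 then p.1 else expC c p / c

open Classical in
/-- A primitive of `expS`. -/
def primS (c : ℝ) (p : ℝ × ℝ) : ℝ := if c = 0 then p.2 else expS c p / c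

theorem contDiff_expC (c : ℝ) : ContDiff ℝ ∞ (expC c) := by
  unfold expC; fun_prop

theorem contDiff_expS (c : ℝ) : ContDiff ℝ ∞ (expS c) := by
  unfold expS; fun_prop

theorem contDiff_primC (c : ℝ) : ContDiff ℝ ∞ (primC c) := by
  unfold primC
  split_ifs
  · fun_prop
  · exact (contDiff_expC c).div_const c

theorem contDiff_primS (c : ℝ) : ContDiff ℝ ∞ (primS c) := by
  unfold primS
  split_ifs
  · fun_prop
  · exact (contDiff_expS c).div_const c

theorem ContDiff.diff {F : Type*} [NormedAddCommGroup F] [NormedSpace ℝ F] {f : ℝ × ℝ → F}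
    (hf : ContDiff ℝ ∞ f) (p : ℝ × ℝ) : DifferentiableAt ℝ f p :=
  hf.differentiable (by simp) p

theorem dirD_expC (c : ℝ) (e p : ℝ × ℝ) :
    dirD e (expC c) p = c * (e.1 * expC c p + e.2 * expS c p) := by
  unfold expC expS
  rw [dirD_mul (by fun_prop) (by fun_prop), dirD_comp_fst (hasDerivAt_exp_mul c p.1),
    dirD_comp_snd (hasDerivAt_cosh_mul c p.2)]
  ring

theorem dirD_expS (c : ℝ) (e p : ℝ × ℝ) :
    dirD e (expS c) p = c * (e.1 * expS c p + e.2 * expC c p) := by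
  unfold expC expS
  rw [dirD_mul (by fun_prop) (by fun_prop), dirD_comp_fst (hasDerivAt_exp_mul c p.1),
    dirD_comp_snd (hasDerivAt_sinh_mul c p.2)]
  ring

theorem dirD_div_const (f : ℝ × ℝ → ℝ) (c : ℝ) (e p : ℝ × ℝ) :
    dirD e (fun q => f q / c) p = dirD e f p / c := by
  have := dirD_const_smul f c⁻¹ e p
  simpa only [smul_eq_mul, div_eq_inv_mul] using this

theorem dirD_primC (c : ℝ) (e p : ℝ × ℝ) :
    dirD e (primC c) p = e.1 * expC c p + e.2 * expS c p := by
  unfold primC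
  split_ifs with hc
  · rw [dirD_comp_fst (hasDerivAt_id' p.1)]
    simp [hc, expC, expS]
  · rw [dirD_div_const (expC c), dirD_expC, mul_div_cancel_left₀ _ hc]

theorem dirD_primS (c : ℝ) (e p : ℝ × ℝ) :
    dirD e (primS c) p = e.1 * expS c p + e.2 * expC c p := by
  unfold primS
  split_ifs with hc
  · rw [dirD_comp_snd (hasDerivAt_id' p.2)]
    simp [hc, expC, expS]
  · rw [dirD_div_const (expS c), dirD_expS, mul_div_cancel_left₀ _ hc]

/-- The vector built from five components in the same way as the explicit surfaces. -/
def modelVec (A B x y z y' z' : ℝ) : Fin 3 → ℝ :=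
  ![x / B, (y / A - A * z) / (2 * B), -((A * z' + y' / A) / (2 * B))]

theorem modelVec_contDiff (A B : ℝ) {x y z y' z' : ℝ × ℝ → ℝ}
    (hx : ContDiff ℝ ∞ x) (hy : ContDiff ℝ ∞ y) (hz : ContDiff ℝ ∞ z) (hy' : ContDiff ℝ ∞ y')
    (hz' : ContDiff ℝ ∞ z') :
    ContDiff ℝ ∞ fun q => modelVec A B (x q) (y q) (z q) (y' q) (z' q) := by
  refine contDiff_pi.2 fun i => ?_
  fin_cases i
  · exact hx.div_const B
  · exact ((hy.div_const A).sub (contDiff_const.mul hz)).div_const _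
  · exact (((contDiff_const.mul hz').add (hy'.div_const A)).div_const _).neg

theorem dirD_modelVec (A B : ℝ) {x y z y' z' : ℝ × ℝ → ℝ}
    (hx : ContDiff ℝ ∞ x) (hy : ContDiff ℝ ∞ y) (hz : ContDiff ℝ ∞ z) (hy' : ContDiff ℝ ∞ y')
    (hz' : ContDiff ℝ ∞ z') (e p : ℝ × ℝ) :
    dirD e (fun q => modelVec A B (x q) (y q) (z q) (y' q) (z' q)) p
      = modelVec A B (dirD e x p) (dirD e y p) (dirD e z p) (dirD e y' p) (dirD e z' p) := by
  have hd := (modelVec_contDiff A B hx hy hz hy' hz').diff p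
  have cm : ∀ f : ℝ × ℝ → ℝ, dirD e (fun q => A * f q) p = A * dirD e f p :=
    fun f => dirD_const_smul f A e p
  ext i
  rw [← dirD_apply hd]
  fin_cases i <;> simp only [modelVec, Fin.zero_eta, Fin.mk_one, Fin.reduceFinMk, Matrix.cons_val]
  · rw [dirD_div_const]
  · rw [dirD_div_const, dirD_sub ((hy.div_const A).diff p) ((contDiff_const.mul hz).diff p),
      dirD_div_const, cm]
  · rw [dirD_neg, dirD_div_const,
      dirD_add ((contDiff_const.mul hz').diff p) ((hy'.div_const A).diff p), dirD_div_const, cm]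

/-- The three parametrizations are one formula in primitives of `exp (cz)`, `z = u + jv`, for `c =
2a, 2a - B, 2a + B`. The exceptional cases are those where one of the last two exponents vanishes
and the primitive becomes `z`. -/
theorem timelikeParam_eq {a A B : ℝ} (ha : a ≠ 0) (hA : A ≠ 0) (hB : B ≠ 0) :
    timelikeParam a A B = fun p => modelVec A B (primC (2 * a) p) (primC (2 * a - B) p)
      (primC (2 * a + B) p) (primS (2 * a - B) p) (primS (2 * a + B) p) := by
  have h2a : 2 * a ≠ 0 := mul_ne_zero two_ne_zero ha
  funext p
  by_cases h1 : B = 2 * a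
  · subst h1
    have h4 : 2 * a + 2 * a ≠ 0 := by contrapose! ha; linarith
    simp only [timelikeParam, if_true, primC, primS, sub_self, h2a, h4, if_false, modelVec,
      paramPlus, expC, expS]
    have e4 : 2 * a + 2 * a = 4 * a := by ring
    ext i
    fin_cases i <;> simp [e4] <;> field_simp <;> ring
  · by_cases h2 : B = -(2 * a)
    · subst h2
      have h4 : 2 * a - -(2 * a) ≠ 0 := by contrapose! ha; linarith
      have e4 : 2 * a - -(2 * a) = 4 * a := by ring
      rw [e4] at h4
      simp only [timelikeParam, h1, if_true, primC, primS, add_neg_cancel, e4, h2a, h4,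
        if_false, modelVec, paramMinus, expC, expS]
      ext i
      fin_cases i <;> simp <;> field_simp <;> ring
    · have hm : 2 * a - B ≠ 0 := fun h => h1 (by linarith)
      have hn : 2 * a + B ≠ 0 := fun h => h2 (by linarith)
      have hmn : 4 * a ^ 2 - B ^ 2 = (2 * a - B) * (2 * a + B) := by ring
      have hexp : Real.exp ((2 * a + B) * p.1)
          = Real.exp ((2 * a - B) * p.1) * Real.exp (2 * B * p.1) := by
        rw [← Real.exp_add]; ring_nf
      simp only [timelikeParam, h1, h2, primC, primS, h2a, hm, hn, if_false, modelVec,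
        paramGeneric, expC, expS, hmn, hexp]
      ext i
      fin_cases i <;> simp <;> field_simp

section Model

variable {a A B : ℝ} (ha : a ≠ 0) (hA : 0 < A) (hB : 0 < B)

include ha hA hB

theorem timelikeParam_contDiff : ContDiff ℝ ∞ (timelikeParam a A B) := by
  rw [timelikeParam_eq ha hA.ne' hB.ne']
  exact modelVec_contDiff A B (contDiff_primC _) (contDiff_primC _) (contDiff_primC _)
    (contDiff_primS _) (contDiff_primS _)

theorem partialU_timelikeParam : partialU (timelikeParam a A B) = fun p =>
    modelVec A B (expC (2 * a) p) (expC (2 * a - B) p) (expC (2 * a + B) p)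
      (expS (2 * a - B) p) (expS (2 * a + B) p) := by
  rw [timelikeParam_eq ha hA.ne' hB.ne']
  funext p
  refine (dirD_modelVec A B (contDiff_primC _) (contDiff_primC _) (contDiff_primC _)
    (contDiff_primS _) (contDiff_primS _) (1, 0) p).trans ?_
  simp [dirD_primC, dirD_primS]

theorem partialV_timelikeParam : partialV (timelikeParam a A B) = fun p =>
    modelVec A B (expS (2 * a) p) (expS (2 * a - B) p) (expS (2 * a + B) p)
      (expC (2 * a - B) p) (expC (2 * a + B) p) := by
  rw [timelikeParam_eq ha hA.ne' hB.ne']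
  funext p
  refine (dirD_modelVec A B (contDiff_primC _) (contDiff_primC _) (contDiff_primC _)
    (contDiff_primS _) (contDiff_primS _) (0, 1) p).trans ?_
  simp [dirD_primC, dirD_primS]

theorem partialUU_timelikeParam : partialU (partialU (timelikeParam a A B)) = fun p =>
    modelVec A B (2 * a * expC (2 * a) p) ((2 * a - B) * expC (2 * a - B) p)
      ((2 * a + B) * expC (2 * a + B) p) ((2 * a - B) * expS (2 * a - B) p)
      ((2 * a + B) * expS (2 * a + B) p) := by
  rw [partialU_timelikeParam ha hA hB]
  funext p
  refine (dirD_modelVec A B (contDiff_expC _) (contDiff_expC _) (contDiff_expC _)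
    (contDiff_expS _) (contDiff_expS _) (1, 0) p).trans ?_
  simp [dirD_expC, dirD_expS]

/-- All components satisfy the wave equation because `j² = 1`; for conformal coordinates this is the
vanishing of the mean curvature. -/
theorem partialVV_timelikeParam : partialV (partialV (timelikeParam a A B)) =
    partialU (partialU (timelikeParam a A B)) := by
  rw [partialUU_timelikeParam ha hA hB, partialV_timelikeParam ha hA hB]
  funext p
  refine (dirD_modelVec A B (contDiff_expS _) (contDiff_expS _) (contDiff_expS _)
    (contDiff_expC _) (contDiff_expC _) (0, 1) p).trans ?_
  simp [dirD_expC, dirD_expS]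

theorem partialUV_timelikeParam : partialU (partialV (timelikeParam a A B)) = fun p =>
    modelVec A B (2 * a * expS (2 * a) p) ((2 * a - B) * expS (2 * a - B) p)
      ((2 * a + B) * expS (2 * a + B) p) ((2 * a - B) * expC (2 * a - B) p)
      ((2 * a + B) * expC (2 * a + B) p) := by
  rw [partialV_timelikeParam ha hA hB]
  funext p
  refine (dirD_modelVec A B (contDiff_expS _) (contDiff_expS _) (contDiff_expS _)
    (contDiff_expC _) (contDiff_expC _) (1, 0) p).trans ?_
  simp [dirD_expC, dirD_expS]

omit ha hA hB in
-- In the null coordinates `u + v` and `u - v` the quantities attached to the explicit surfaces are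
-- rational in exponentials, so that their identities can be checked by algebra.
theorem expC_eq (c : ℝ) (p : ℝ × ℝ) :
    expC c p = (Real.exp (c * (p.1 + p.2)) + Real.exp (c * (p.1 - p.2))) / 2 := by
  rw [expC, Real.cosh_eq, mul_add, mul_sub, Real.exp_add, Real.exp_sub, Real.exp_neg]
  field_simp

omit ha hA hB in
theorem expS_eq (c : ℝ) (p : ℝ × ℝ) :
    expS c p = (Real.exp (c * (p.1 + p.2)) - Real.exp (c * (p.1 - p.2))) / 2 := by
  rw [expS, Real.sinh_eq, mul_add, mul_sub, Real.exp_add, Real.exp_sub, Real.exp_neg]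
  field_simp

omit ha hA hB in
theorem modelE_eq (a A B : ℝ) (p : ℝ × ℝ) : modelE a A B p.1 =
    Real.exp (2 * a * (p.1 + p.2)) * Real.exp (2 * a * (p.1 - p.2)) *
      (A ^ 2 * (Real.exp (B * (p.1 + p.2)) * Real.exp (B * (p.1 - p.2))) + 1) ^ 2 /
    (4 * A ^ 2 * B ^ 2 * (Real.exp (B * (p.1 + p.2)) * Real.exp (B * (p.1 - p.2)))) := by
  rw [modelE, ← Real.exp_add, ← Real.exp_add]
  ring_nf

omit ha in
theorem modelE_pos (u : ℝ) : 0 < modelE a A B u := by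
  unfold modelE; positivity

theorem lorentz_uu_timelikeParam (p : ℝ × ℝ) :
    metricE (timelikeParam a A B) p = modelE a A B p.1 := by
  rw [metricE, partialU_timelikeParam ha hA hB, modelE_eq]
  simp only [expC_eq, expS_eq, sub_mul (2 * a) B, add_mul (2 * a) B, Real.exp_add, Real.exp_sub,
    modelVec, lorentz, Matrix.cons_val]
  have h1 := (Real.exp_pos (B * (p.1 + p.2))).ne'
  have h2 := (Real.exp_pos (B * (p.1 - p.2))).ne'
  generalize Real.exp (B * (p.1 + p.2)) = P at *
  generalize Real.exp (B * (p.1 - p.2)) = Q at *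
  field_simp
  ring

theorem lorentz_vv_timelikeParam (p : ℝ × ℝ) :
    lorentz (partialV (timelikeParam a A B) p) (partialV (timelikeParam a A B) p)
      = -modelE a A B p.1 := by
  rw [partialV_timelikeParam ha hA hB, modelE_eq]
  simp only [expC_eq, expS_eq, sub_mul (2 * a) B, add_mul (2 * a) B, Real.exp_add, Real.exp_sub,
    modelVec, lorentz, Matrix.cons_val]
  have h1 := (Real.exp_pos (B * (p.1 + p.2))).ne'
  have h2 := (Real.exp_pos (B * (p.1 - p.2))).ne'
  generalize Real.exp (B * (p.1 + p.2)) = P at *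
  generalize Real.exp (B * (p.1 - p.2)) = Q at *
  field_simp
  ring

theorem lorentz_uv_timelikeParam (p : ℝ × ℝ) :
    lorentz (partialU (timelikeParam a A B) p) (partialV (timelikeParam a A B) p) = 0 := by
  rw [partialU_timelikeParam ha hA hB, partialV_timelikeParam ha hA hB]
  simp only [expC_eq, expS_eq, sub_mul (2 * a) B, add_mul (2 * a) B, Real.exp_add, Real.exp_sub,
    modelVec, lorentz, Matrix.cons_val]
  have h1 := (Real.exp_pos (B * (p.1 + p.2))).ne'
  have h2 := (Real.exp_pos (B * (p.1 - p.2))).ne'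
  generalize Real.exp (B * (p.1 + p.2)) = P at *
  generalize Real.exp (B * (p.1 - p.2)) = Q at *
  field_simp
  ring

theorem unitNormal_timelikeParam (p : ℝ × ℝ) :
    unitNormal (timelikeParam a A B) p = (modelE a A B p.1)⁻¹ •
      lorentzCross (partialU (timelikeParam a A B) p) (partialV (timelikeParam a A B) p) := by
  have hE := lorentz_uu_timelikeParam ha hA hB p
  rw [← hE]
  exact unitNormal_eq (hE ▸ modelE_pos hA hB p.1)
    (hE ▸ lorentz_vv_timelikeParam ha hA hB p) (lorentz_uv_timelikeParam ha hA hB p)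

theorem adaptedFrame_timelikeParam :
    AdaptedFrame Set.univ (timelikeParam a A B) (unitNormal (timelikeParam a A B)) := by
  have hE := lorentz_uu_timelikeParam ha hA hB
  refine AdaptedFrame.of_unitNormal isOpen_univ (timelikeParam_contDiff ha hA hB).contDiffOn
    (fun p _ => hE p ▸ modelE_pos hA hB p.1)
    (fun p _ => hE p ▸ lorentz_vv_timelikeParam ha hA hB p)
    (fun p _ => lorentz_uv_timelikeParam ha hA hB p) (fun p _ => ?_) fun p _ => ?_
  · have su := contDiffOn_dirD isOpen_univ (timelikeParam_contDiff ha hA hB).contDiffOn (1, 0)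
    exact dirD_snd_eq_zero isOpen_univ (contDiffOn_lorentz su su) (fun q _ => hE q) trivial
  · rw [partialVV_timelikeParam ha hA hB]

theorem formUU_timelikeParam (p : ℝ × ℝ) :
    formUU (timelikeParam a A B) (unitNormal (timelikeParam a A B)) p = -expC (2 * a) p := by
  rw [formUU, unitNormal_timelikeParam ha hA hB, lorentz_smul_right,
    inv_mul_eq_iff_eq_mul₀ (modelE_pos hA hB p.1).ne', partialUU_timelikeParam ha hA hB,
    partialU_timelikeParam ha hA hB, partialV_timelikeParam ha hA hB, modelE_eq]
  simp only [expC_eq, expS_eq, sub_mul (2 * a) B, add_mul (2 * a) B, Real.exp_add, Real.exp_sub,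
    modelVec, lorentz, lorentzCross, Matrix.cons_val]
  have h1 := (Real.exp_pos (B * (p.1 + p.2))).ne'
  have h2 := (Real.exp_pos (B * (p.1 - p.2))).ne'
  generalize Real.exp (B * (p.1 + p.2)) = P at *
  generalize Real.exp (B * (p.1 - p.2)) = Q at *
  field_simp
  ring

theorem formUV_timelikeParam (p : ℝ × ℝ) :
    formUV (timelikeParam a A B) (unitNormal (timelikeParam a A B)) p = -expS (2 * a) p := by
  rw [formUV, unitNormal_timelikeParam ha hA hB, lorentz_smul_right,
    inv_mul_eq_iff_eq_mul₀ (modelE_pos hA hB p.1).ne', partialUV_timelikeParam ha hA hB,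
    partialU_timelikeParam ha hA hB, partialV_timelikeParam ha hA hB, modelE_eq]
  simp only [expC_eq, expS_eq, sub_mul (2 * a) B, add_mul (2 * a) B, Real.exp_add, Real.exp_sub,
    modelVec, lorentz, lorentzCross, Matrix.cons_val]
  have h1 := (Real.exp_pos (B * (p.1 + p.2))).ne'
  have h2 := (Real.exp_pos (B * (p.1 - p.2))).ne'
  generalize Real.exp (B * (p.1 + p.2)) = P at *
  generalize Real.exp (B * (p.1 - p.2)) = Q at *
  field_simp
  ring

end Model

/-! ### The Weingarten endomorphism -/

/-- The trace-free case, where the conjugation doubles the angle: a twist `av` yields forms in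
`2av`. -/
theorem rotG_conj (θ l : ℝ) : rotG (-θ) * !![l, 0; 0, -l] * rotG θ =
    !![l * Real.cosh (2 * θ), l * Real.sinh (2 * θ);
      -(l * Real.sinh (2 * θ)), -(l * Real.cosh (2 * θ))] := by
  have h1 := Real.cosh_two_mul θ
  have h2 := Real.sinh_two_mul θ
  ext i j
  fin_cases i <;> fin_cases j <;> simp [rotG, h1, h2] <;> ring

theorem trace_rotG_conj (θ l m : ℝ) : (rotG (-θ) * !![l, 0; 0, m] * rotG θ).trace = l + m := by
  have h := Real.cosh_sq θ
  simp [rotG, Matrix.trace, Fin.sum_univ_two]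
  linear_combination (l + m) * h

theorem weingarten_eq {X : ℝ × ℝ → Fin 3 → ℝ} {p : ℝ × ℝ} {E e f : ℝ} (hE : E ≠ 0)
    (h1 : firstForm X p = E • !![1, 0; 0, -1]) (h2 : secondForm X p = !![e, f; f, e]) :
    weingarten X p = !![e / E, f / E; -(f / E), -(e / E)] := by
  have hinv : (firstForm X p)⁻¹ = E⁻¹ • !![1, 0; 0, -1] := by
    apply Matrix.inv_eq_right_inv
    rw [h1]
    ext i j
    fin_cases i <;> fin_cases j <;> simp [hE]
  rw [weingarten, hinv, h2]
  ext i j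
  fin_cases i <;> fin_cases j <;> simp [div_eq_inv_mul]

theorem secondForm_eq_mul {X : ℝ × ℝ → Fin 3 → ℝ} {p : ℝ × ℝ} (h : (firstForm X p).det ≠ 0) :
    secondForm X p = firstForm X p * weingarten X p := by
  rw [weingarten, Matrix.mul_nonsing_inv_cancel_left _ _ (isUnit_iff_ne_zero.2 h)]

theorem det_smul_signature (r : ℝ) : (r • !![1, 0; 0, (-1 : ℝ)]).det = -(r * r) := by
  simp [Matrix.det_fin_two]

/-! ### Classification -/

/-- A surface with zero mean curvature and linear twist has the fundamental forms of a scaled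
explicit surface. -/
theorem exists_adaptedFrame {a : ℝ} {Ω : Set (ℝ × ℝ)} {X : ℝ × ℝ → Fin 3 → ℝ}
    (hX : IsIntrinsicRotational 1 (-1) Ω X) (hz : IsZMCOn Ω X)
    (ht : HasTwist Ω X fun v => a * v) (hu : NoOpenUmbilicSet Ω X) :
    ∃ (N : ℝ × ℝ → Fin 3 → ℝ) (C A B : ℝ), AdaptedFrame Ω X N ∧ 0 < C ∧ 0 < A ∧ 0 < B ∧
      (∀ p ∈ Ω, formUU X N p = C * -expC (2 * a) p) ∧
      (∀ p ∈ Ω, formUV X N p = C * -expS (2 * a) p) ∧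
      ∀ p ∈ Ω, metricE X p = C ^ 2 * modelE a A B p.1 := by
  obtain ⟨hΩ, hc, hs, -, -, ρ, hρ⟩ := hX
  have hdet : ∀ p ∈ Ω, (firstForm X p).det < 0 := fun p hp => by
    have := (hρ p hp).1
    rw [(hρ p hp).2, det_smul_signature]
    exact neg_neg_of_pos (by positivity)
  obtain ⟨p₀, hp₀⟩ := hc.nonempty
  obtain ⟨-, l₁, l₂, ⟨hsp, -⟩ | ⟨-, hW⟩⟩ := ht
  -- The metric `ρ² (du² - dv²)` has negative determinant, which excludes the spacelike form of the
  -- twist.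
  · exact absurd (hsp p₀ hp₀).det_pos (hdet p₀ hp₀).not_gt
  have hl : ∀ p ∈ Ω, l₂ p.1 = -l₁ p.1 := fun p hp => by
    have h1 := hz p hp
    rw [meanCurvature, sign_neg (hdet p hp), hW p hp, trace_rotG_conj] at h1
    simp at h1
    linarith
  replace hW : ∀ p ∈ Ω, weingarten X p =
      !![l₁ p.1 * Real.cosh (2 * a * p.2), l₁ p.1 * Real.sinh (2 * a * p.2);
        -(l₁ p.1 * Real.sinh (2 * a * p.2)), -(l₁ p.1 * Real.cosh (2 * a * p.2))] := by
    intro p hp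
    rw [hW p hp, hl p hp, rotG_conj, mul_assoc]
  have hII : ∀ p ∈ Ω, ∀ i j, secondForm X p i j = _ := fun p hp i j =>
    congrFun (congrFun (secondForm_eq_mul (hdet p hp).ne) i) j
  have hI : ∀ p ∈ Ω, ∀ i j, firstForm X p i j = _ := fun p hp i j =>
    congrFun (congrFun (hρ p hp).2 i) j
  have hE : ∀ p ∈ Ω, metricE X p = ρ p.1 ^ 2 := fun p hp => by
    simpa [metricE, firstForm] using hI p hp 0 0
  have huu : ∀ p ∈ Ω, formUU X (unitNormal X) p
      = ρ p.1 ^ 2 * l₁ p.1 * Real.cosh (2 * a * p.2) := fun p hp => by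
    have := hII p hp 0 0
    rw [(hρ p hp).2, hW p hp] at this
    simpa [formUU, secondForm, mul_assoc] using this
  have huv : ∀ p ∈ Ω, formUV X (unitNormal X) p
      = ρ p.1 ^ 2 * l₁ p.1 * Real.sinh (2 * a * p.2) := fun p hp => by
    have := hII p hp 0 1
    rw [(hρ p hp).2, hW p hp] at this
    simpa [formUV, secondForm, mul_assoc] using this
  have hvv : ∀ p ∈ Ω, lorentz (partialV (partialV X) p) (unitNormal X p)
      = ρ p.1 ^ 2 * l₁ p.1 * Real.cosh (2 * a * p.2) := fun p hp => by
    have := hII p hp 1 1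
    rw [(hρ p hp).2, hW p hp] at this
    simpa [secondForm, mul_assoc] using this
  have su := contDiffOn_dirD hΩ hs (1, 0)
  have hF : AdaptedFrame Ω X (unitNormal X) := by
    refine .of_unitNormal hΩ hs (fun p hp => ?_) (fun p hp => ?_) (fun p hp => ?_)
      (fun p hp => ?_) fun p hp => ?_
    · rw [hE p hp]
      have := (hρ p hp).1
      positivity
    · rw [hE p hp]
      simpa [firstForm] using hI p hp 1 1
    · simpa [firstForm] using hI p hp 0 1
    · exact dirD_snd_eq_zero hΩ (contDiffOn_lorentz su su) (g := fun u => ρ u ^ 2) hE hp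
    · exact (hvv p hp).trans (huu p hp).symm
  -- No regularity of `ρ` or `l₁` is given, so `H = ρ² l₁` is handled as the quotient `e / cosh
  -- (2av)`, which is smooth.
  have hH : ∀ p ∈ Ω, formUU X (unitNormal X) p / Real.cosh (2 * a * p.2)
      = ρ p.1 ^ 2 * l₁ p.1 := fun p hp => by
    rw [huu p hp, mul_div_cancel_right₀ _ (Real.cosh_pos _).ne']
  have sH : ContDiffOn ℝ ∞
      (fun p => formUU X (unitNormal X) p / Real.cosh (2 * a * p.2)) Ω :=
    hF.smooth_formUU.div (ContDiff.contDiffOn (by fun_prop)) fun p _ => (Real.cosh_pos _).ne'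
  -- If `H` vanished identically, so would the Weingarten endomorphism, and the nonempty open set
  -- `Ω` would consist of umbilic points.
  have hne : ∃ p ∈ Ω, formUU X (unitNormal X) p / Real.cosh (2 * a * p.2) ≠ 0 := by
    by_contra! hall
    have hset : {p | p ∈ Ω ∧ IsUmbilicAt X p} = Ω := by
      refine Set.Subset.antisymm (fun p hp => hp.1) fun p hp => ⟨hp, 0, ?_⟩
      have h1 := hH p hp
      rw [hall p hp, eq_comm, mul_eq_zero] at h1
      have h2 := h1.resolve_left (pow_pos (hρ p hp).1 2).ne'
      rw [hW p hp, h2]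
      ext i j
      fin_cases i <;> fin_cases j <;> simp
    rw [NoOpenUmbilicSet, hset, hΩ.interior_eq] at hu
    simp [hu] at hp₀
  obtain ⟨C, A, B, hC, hA, hB, hHC, hEC⟩ := hF.forms_eq hc (a := a) sH
    (fun p hp => dirD_snd_eq_zero hΩ sH (g := fun u => ρ u ^ 2 * l₁ u) hH hp)
    (fun p _ => by rw [div_mul_cancel₀ _ (Real.cosh_pos _).ne'])
    (fun p hp => by rw [hH p hp, huv p hp]) hne
  have hUU : ∀ p ∈ Ω, formUU X (unitNormal X) p = C * expC (2 * a) p := fun p hp => by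
    rw [huu p hp, ← hH p hp, hHC p hp, expC, mul_assoc]
  have hUV : ∀ p ∈ Ω, formUV X (unitNormal X) p = C * expS (2 * a) p := fun p hp => by
    rw [huv p hp, ← hH p hp, hHC p hp, expS, mul_assoc]
  -- The second form of the explicit surface carries a minus sign, so the normal is reversed exactly
  -- when `C > 0`.
  rcases hC.lt_or_gt with hneg | hpos
  · refine ⟨_, -C, A, B, hF, neg_pos.2 hneg, hA, hB, fun p hp => ?_, fun p hp => ?_,
      fun p hp => ?_⟩
    · rw [hUU p hp, neg_mul_neg]
    · rw [hUV p hp, neg_mul_neg]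
    · rw [hEC p hp, neg_sq]
  · refine ⟨_, C, A, B, hF.neg, hpos, hA, hB, fun p hp => ?_, fun p hp => ?_, hEC⟩
    · rw [formUU, lorentz_neg_right, ← formUU, hUU p hp, mul_neg]
    · rw [formUV, lorentz_neg_right, ← formUV, hUV p hp, mul_neg]

theorem classification {a : ℝ} (ha : a ≠ 0) {Ω : Set (ℝ × ℝ)} {X : ℝ × ℝ → Fin 3 → ℝ}
    (hX : IsIntrinsicRotational 1 (-1) Ω X) (hz : IsZMCOn Ω X)
    (ht : HasTwist Ω X fun v => a * v) (hu : NoOpenUmbilicSet Ω X) :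
    (∃ A B c : ℝ, 0 < A ∧ 0 < B ∧ 0 < c ∧ ∃ Φ : (Fin 3 → ℝ) → (Fin 3 → ℝ),
      IsLorentzIsometry Φ ∧ ∀ p ∈ Ω, X p = Φ (c • timelikeParam a A B p)) ∧
    (∃ A B t : ℝ, 0 < A ∧ 0 < B ∧ ∃ Φ : (Fin 3 → ℝ) → (Fin 3 → ℝ),
      IsLorentzIsometry Φ ∧ ∀ p ∈ Ω, X p = Φ (timelikeParam a A B (p.1 + t, p.2))) := by
  obtain ⟨N, C, A, B, hF, hC, hA, hB, hUU, hUV, hE⟩ := exists_adaptedFrame hX hz ht hu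
  constructor
  · refine ⟨A, B, C, hA, hB, hC, hF.exists_isometry
      (((adaptedFrame_timelikeParam ha hA hB).const_smul hC).mono hX.isOpen (Set.subset_univ _))
      hX.isConnected (fun p hp => ?_) (fun p hp => ?_) fun p hp => ?_⟩
    · rw [hE p hp, metricE_const_smul, lorentz_uu_timelikeParam ha hA hB]
    · rw [hUU p hp, formUU_const_smul, formUU_timelikeParam ha hA hB]
    · rw [hUV p hp, formUV_const_smul, formUV_timelikeParam ha hA hB]
  -- The shift by `t` multiplies `exp (2au)` by `exp (2at)`, which must equal `C`. It also
  -- multiplies `exp (2Bu)` by `exp (2Bt)`, which replacing `A` by `A exp (-Bt)` compensates.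
  · obtain ⟨t, ht⟩ : ∃ t, Real.exp (2 * a * t) = C :=
      ⟨Real.log C / (2 * a), by rw [mul_div_cancel₀ _ (by simpa using ha), Real.exp_log hC]⟩
    have hA' : 0 < A * Real.exp (-(B * t)) := by positivity
    have hexp : ∀ c x : ℝ, Real.exp (c * (x + t)) = Real.exp (c * t) * Real.exp (c * x) :=
      fun c x => by rw [← Real.exp_add]; ring_nf
    refine ⟨A * Real.exp (-(B * t)), B, t, hA', hB, ?_⟩
    have hq : ∀ p : ℝ × ℝ, (p.1 + t, p.2) = p + (t, 0) := fun p => by simp [Prod.add_def]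
    simp only [hq]
    refine hF.exists_isometry
      (((adaptedFrame_timelikeParam ha hA' hB).translate (t, 0)).mono hX.isOpen
        (Set.subset_univ _)) hX.isConnected (fun p hp => ?_) (fun p hp => ?_) fun p hp => ?_
    · rw [hE p hp, metricE_translate, lorentz_uu_timelikeParam ha hA' hB, ← ht, modelE, modelE,
        Prod.fst_add, hexp, hexp, show 4 * a * t = 2 * a * t + 2 * a * t by ring,
        show 2 * B * t = B * t + B * t by ring, Real.exp_add, Real.exp_add, Real.exp_neg]
      field_simp
    · rw [hUU p hp, formUU_translate, formUU_timelikeParam ha hA' hB, ← ht, expC, expC,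
        Prod.fst_add, Prod.snd_add, hexp, add_zero]
      ring
    · rw [hUV p hp, formUV_translate, formUV_timelikeParam ha hA' hB, ← ht, expS, expS,
        Prod.fst_add, Prod.snd_add, hexp, add_zero]
      ring

/-! ### Properties of the explicit surfaces -/

section Model

variable {a A B : ℝ} (ha : a ≠ 0) (hA : 0 < A) (hB : 0 < B)

include ha hA hB

theorem firstForm_timelikeParam (p : ℝ × ℝ) :
    firstForm (timelikeParam a A B) p = modelE a A B p.1 • !![1, 0; 0, -1] := by
  have h1 := lorentz_uu_timelikeParam ha hA hB p
  have h2 := lorentz_uv_timelikeParam ha hA hB p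
  rw [metricE] at h1
  rw [firstForm, h1, h2, lorentz_comm (partialV _ p), h2, lorentz_vv_timelikeParam ha hA hB]
  ext i j
  fin_cases i <;> fin_cases j <;> simp

theorem weingarten_timelikeParam (p : ℝ × ℝ) : weingarten (timelikeParam a A B) p =
    rotG (-(a * p.2)) * !![-Real.exp (2 * a * p.1) / modelE a A B p.1, 0;
      0, -(-Real.exp (2 * a * p.1) / modelE a A B p.1)] * rotG (a * p.2) := by
  have hII : secondForm (timelikeParam a A B) p
      = !![-expC (2 * a) p, -expS (2 * a) p; -expS (2 * a) p, -expC (2 * a) p] := by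
    have hF := adaptedFrame_timelikeParam ha hA hB
    rw [secondForm, hF.zmc p trivial, hF.mixed trivial, ← formUU, ← formUV,
      formUU_timelikeParam ha hA hB, formUV_timelikeParam ha hA hB]
  rw [weingarten_eq (modelE_pos hA hB p.1).ne' (firstForm_timelikeParam ha hA hB p) hII, rotG_conj,
    ← mul_assoc]
  ext i j
  fin_cases i <;> fin_cases j <;> simp [expC, expS] <;> ring

theorem isTimelikeOn_timelikeParam : IsTimelikeOn Set.univ (timelikeParam a A B) := by
  intro p _
  have := modelE_pos (a := a) hA hB p.1
  rw [firstForm_timelikeParam ha hA hB, det_smul_signature]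
  exact neg_neg_of_pos (by positivity)

theorem isIntrinsicRotational_timelikeParam :
    IsIntrinsicRotational 1 (-1) Set.univ (timelikeParam a A B) where
  isOpen := isOpen_univ
  isConnected := isConnected_univ
  smooth := (timelikeParam_contDiff ha hA hB).contDiffOn
  sign_left := .inl rfl
  sign_right := .inr rfl
  metric := ⟨fun u => √(modelE a A B u), fun p _ => by
    have := modelE_pos (a := a) hA hB p.1
    exact ⟨Real.sqrt_pos.2 this, by rw [Real.sq_sqrt this.le, firstForm_timelikeParam ha hA hB]⟩⟩

theorem isZMCOn_timelikeParam : IsZMCOn Set.univ (timelikeParam a A B) := by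
  intro p _
  rw [meanCurvature, weingarten_timelikeParam ha hA hB, trace_rotG_conj, add_neg_cancel]
  simp

theorem hasTwist_timelikeParam : HasTwist Set.univ (timelikeParam a A B) fun v => a * v :=
  ⟨by fun_prop, fun u => -Real.exp (2 * a * u) / modelE a A B u,
    fun u => -(-Real.exp (2 * a * u) / modelE a A B u), .inr ⟨isTimelikeOn_timelikeParam ha hA hB,
      fun p _ => weingarten_timelikeParam ha hA hB p⟩⟩

/-- The diagonal entries are opposite and nonzero, because the exponential and `cosh` never vanish,
so they cannot be equal. -/
theorem not_isUmbilicAt_timelikeParam (p : ℝ × ℝ) : ¬IsUmbilicAt (timelikeParam a A B) p := by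
  rintro ⟨c, hc⟩
  rw [weingarten_timelikeParam ha hA hB, rotG_conj] at hc
  have h1 := congrFun (congrFun hc 0) 0
  have h2 := congrFun (congrFun hc 1) 1
  simp only [Matrix.of_apply, Matrix.cons_val', Matrix.cons_val, Matrix.smul_apply,
    Matrix.one_apply_eq, smul_eq_mul, mul_one] at h1 h2
  have h3 : -Real.exp (2 * a * p.1) / modelE a A B p.1 * Real.cosh (2 * (a * p.2)) ≠ 0 :=
    mul_ne_zero (div_ne_zero (neg_ne_zero.2 (Real.exp_pos _).ne') (modelE_pos hA hB p.1).ne')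
      (Real.cosh_pos _).ne'
  exact h3 (by linarith)

end Model

end

/-! ### The main theorem -/

theorem mainTheorem3 :
    -- every surface of the class is one of the explicit surfaces
    (∀ (a : ℝ) (_ : a ≠ 0) (Ω : Set (ℝ × ℝ)) (X : ℝ × ℝ → Fin 3 → ℝ),
      IsIntrinsicRotational 1 (-1) Ω X →
      IsZMCOn Ω X →
      HasTwist Ω X (fun v => a * v) →
      NoOpenUmbilicSet Ω X →
      -- in the given coordinates, up to a homothety and an isometry
      (∃ A B c : ℝ, 0 < A ∧ 0 < B ∧ 0 < c ∧ ∃ Φ : (Fin 3 → ℝ) → (Fin 3 → ℝ),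
        IsLorentzIsometry Φ ∧ ∀ p ∈ Ω, X p = Φ (c • timelikeParam a A B p)) ∧
      -- without homothety, after a translation of the coordinate `u`
      (∃ A B t : ℝ, 0 < A ∧ 0 < B ∧ ∃ Φ : (Fin 3 → ℝ) → (Fin 3 → ℝ),
        IsLorentzIsometry Φ ∧ ∀ p ∈ Ω, X p = Φ (timelikeParam a A B (p.1 + t, p.2)))) ∧
    -- the explicit surfaces are defined on the whole plane and belong to the class
    (∀ a A B : ℝ, a ≠ 0 → 0 < A → 0 < B →
      IsIntrinsicRotational 1 (-1) Set.univ (timelikeParam a A B) ∧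
      IsTimelikeOn Set.univ (timelikeParam a A B) ∧
      IsZMCOn Set.univ (timelikeParam a A B) ∧
      HasTwist Set.univ (timelikeParam a A B) (fun v => a * v) ∧
      NoOpenUmbilicSet Set.univ (timelikeParam a A B) ∧
      -- their first fundamental forms
      (B ≠ 2 * a → B ≠ -(2 * a) → ∀ u v : ℝ,
        firstForm (timelikeParam a A B) (u, v) =
          (Real.exp ((4 * a - 2 * B) * u) * (A ^ 2 * Real.exp (2 * B * u) + 1) ^ 2 /
            (4 * A ^ 2 * B ^ 2)) • !![1, 0; 0, -1]) ∧
      (B = 2 * a → ∀ u v : ℝ,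
        firstForm (timelikeParam a A B) (u, v) =
          ((A ^ 2 * Real.exp (4 * a * u) + 1) ^ 2 / (16 * a ^ 2 * A ^ 2)) • !![1, 0; 0, -1]) ∧
      (B = -(2 * a) → ∀ u v : ℝ,
        firstForm (timelikeParam a A B) (u, v) =
          ((A ^ 2 + Real.exp (4 * a * u)) ^ 2 / (16 * a ^ 2 * A ^ 2)) • !![1, 0; 0, -1])) ∧
    -- the case `A = B = a = 1` is the timelike Enneper surface
    (∃ Φ : (Fin 3 → ℝ) → (Fin 3 → ℝ), IsLorentzIsometry Φ ∧ ∀ u v : ℝ,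
      timelikeParam 1 1 1 (u, v) =
        Φ ((1 / 2 : ℝ) • timelikeEnneper (Real.exp u * Real.cosh v, Real.exp u * Real.sinh v))) := by
  refine ⟨fun a ha Ω X hX hz ht hu => classification ha hX hz ht hu, fun a A B ha hA hB =>
    ⟨isIntrinsicRotational_timelikeParam ha hA hB, isTimelikeOn_timelikeParam ha hA hB,
      isZMCOn_timelikeParam ha hA hB, hasTwist_timelikeParam ha hA hB, ?_, fun _ _ u v => ?_,
      fun h u v => ?_, fun h u v => ?_⟩, ?_⟩
  · simp [NoOpenUmbilicSet, not_isUmbilicAt_timelikeParam ha hA hB]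
  · rw [firstForm_timelikeParam ha hA hB, modelE, sub_mul, Real.exp_sub]
    congr 1
    field_simp
  · rw [firstForm_timelikeParam ha hA hB, modelE, h, show 2 * (2 * a) = 4 * a by ring]
    congr 1
    field_simp
    ring
  · rw [firstForm_timelikeParam ha hA hB, modelE, h,
      show 2 * -(2 * a) * u = -(4 * a * u) by ring, Real.exp_neg]
    congr 1
    field_simp
    ring
  -- The isometry is the reflection `x₃ ↦ -x₃`. The components then agree by the double and triple
  -- argument formulas and `cosh² = sinh² + 1`.
  · refine ⟨fun x => !![1, 0, 0; 0, 1, 0; 0, 0, -1] *ᵥ x + 0, ⟨_, _, fun x y => ?_, fun _ => rfl⟩,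
      fun u v => ?_⟩
    · simp [lorentz, Matrix.mulVec, dotProduct, Fin.sum_univ_three]
    · have e2 : Real.exp (2 * u) = Real.exp u ^ 2 := by rw [← Real.exp_nat_mul]; norm_num
      have c2 := Real.cosh_two_mul v
      have c3 := Real.cosh_three_mul v
      have s3 := Real.sinh_three_mul v
      have hcs := Real.cosh_sq v
      rw [timelikeParam, if_neg (by norm_num), if_neg (by norm_num)]
      ext i
      fin_cases i <;>
        norm_num [paramGeneric, timelikeEnneper, Matrix.mulVec, dotProduct, Fin.sum_univ_three,
          e2, c2, c3, s3]
      · ring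
      · linear_combination (-1 / 2 * Real.exp u ^ 3 * Real.cosh v) * hcs
      · linear_combination (-1 / 2 * Real.exp u ^ 3 * Real.sinh v) * hcs
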